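/- **Lemma 6.1** ($L^2$ estimate). Write $e(x)=e^{2\pi i x}$ and $\widehat f(\xi,\eta)=\int_{\mathbb{R}^2} e(-\xi x-\eta y)f(x,y)\,dx\,dy$. Let $\theta_+,\widehat\Phi_+:\mathbb{R}\to\mathbb{R}$ be smooth functions, supported in $(\tfrac19,9)$ and in $[\tfrac12,2]$ respectively, with $\sum_{j\in\mathbb{Z}}\theta_+(2^jt)=\sum_{j\in\mathbb{Z}}\widehat\Phi_+(2^jt)=1$ for all $t>0$. Put $\theta_-(t)=\theta_+(-t)$, $\widehat\Phi_-(t)=\widehat\Phi_+(-t)$ and $\rho_\pm(t)=\theta_\pm(t)/t$. Let $N\ge2$, $2\le l\le N$, let $P(t)=\sum_{i=2}^N a_it^i$ have real coefficients with $a_l=1$, and let $u:\mathbb{R}\to\mathbb{R}$ be measurable. For $K>0$ let $$S_l=\{j\in\mathbb{Z}:\ |j|>2^N,\ |a_l|2^{-jl}>K|a_i|2^{-ji}\ \text{ for all } 2\le i\le N,\ i\ne l\}.$$ For signs $\omega=(\omega_1,\omega_2,\omega_3,\omega_4)\in\{+,-\}^4$ and an integer $m>0$ define, for Schwartz functions $f$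 on $\mathbb{R}^2$, $$\mathcal{H}_{\Delta_4,m}f(x,y)=\int_{\mathbb{R}^2}\widehat f(\xi,\eta)\,e(\xi x+\eta y)\sum_{j\in S_l}M_{j,m,\Delta_4}(\xi,\eta)\,d\xi\,d\eta,$$ $$M_{j,m,\Delta_4}(\xi,\eta)=\sum_{k\in\mathbb{Z}}\widehat\Phi_{\omega_1}\Big(\frac{\xi}{2^{jl+m}}\Big)\widehat\Phi_{\omega_2}\Big(\frac{\eta}{2^k}\Big)\widehat\Phi_{\omega_3}\Big(\frac{u(x)}{2^{j-k+m}}\Big)\int_{\mathbb{R}} e\big(\xi P(2^{-j}t)+\eta u(x)2^{-j}t\big)\rho_{\omega_4}(t)\,dt .$$ Then there are $\epsilon_0>0$ and $K_0>0$ depending only on $N$, and a constant $C$ depending only on $N$, $\theta_+$ and $\widehat\Phi_+$, such that, whenever $K\ge K_0$, for all $l$, all coefficients $(a_i)$ with $a_l=1$, all measurable $u$, all signs $\omega$ and all integers $m>0$, the operator $\mathcal{H}_{\Delta_4,m}$ extends to a bounded linear operator on $L^2(\mathbb{R}^2)$ and $$\|\mathcal{H}_{\Delta_4,m}f\|_2\le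 C\,2^{-\epsilon_0m}\|f\|_2\qquad\text{for all } f\in L^2(\mathbb{R}^2).$$ -/

import Mathlib

open MeasureTheory
open scoped SchwartzMap ContDiff

namespace PolyHilbert

noncomputable section

/-- The character `e(x) = exp (2πix)`. -/
def e (x : ℝ) : ℂ := Complex.exp (2 * Real.pi * Complex.I * x)

/-- The Fourier transform on the plane, `f̂(ξ, η) = ∫ e(-(ξ x + η y)) f(x, y) dx dy`. -/
def fourier (f : ℝ × ℝ → ℂ) (ζ : ℝ × ℝ) : ℂ :=
  ∫ z : ℝ × ℝ, e (-(ζ.1 * z.1 + ζ.2 * z.2)) * f z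

/-- A smooth function `ψ` on the line that vanishes outside `s` (a subset of the positive half-line
in the applications) and whose dyadic dilates sum to one on the positive half-line. -/
structure IsDyadicCutoff (ψ : ℝ → ℝ) (s : Set ℝ) : Prop where
  smooth : ContDiff ℝ ∞ ψ
  support_subset : Function.support ψ ⊆ s
  hasSum_one : ∀ t : ℝ, 0 < t → HasSum (fun j : ℤ => ψ ((2 : ℝ) ^ j * t)) 1

/-- For `ψ = ψ₊` living on the positive half-line and a sign `σ`, the function `ψ_σ`, that is
`ψ₊(t)` for `σ = 1` and `ψ₋(t) = ψ₊(-t)` for `σ = -1`. -/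
def signed (ψ : ℝ → ℝ) (σ : ℤˣ) (t : ℝ) : ℝ := ψ (((σ : ℤ) : ℝ) * t)

/-- The polynomial `P(t) = ∑_{i=2}^N a_i t^i`. -/
def poly (N : ℕ) (a : ℕ → ℝ) (t : ℝ) : ℝ := ∑ i ∈ Finset.Icc 2 N, a i * t ^ i

/-- The scales `j` with `|j| > 2^N` at which the monomial `a_l t^l` dominates `P(2^{-j} t)`, with
dominance constant `K`. -/
def dominatingSet (N : ℕ) (K : ℝ) (a : ℕ → ℝ) (l : ℕ) : Set ℤ :=
  {j : ℤ | (2 : ℤ) ^ N < |j| ∧ ∀ i : ℕ, 2 ≤ i → i ≤ N → i ≠ l →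
    K * (|a i| * (2 : ℝ) ^ (-(j * (i : ℤ)))) < |a l| * (2 : ℝ) ^ (-(j * (l : ℤ)))}

/-- The phase `φ_{j,ξ,η,x}(t) = ξ P(2^{-j} t) + η u(x) 2^{-j} t`, where `v` stands for `u(x)`. -/
def phase (N : ℕ) (a : ℕ → ℝ) (j : ℤ) (v : ℝ) (ζ : ℝ × ℝ) (t : ℝ) : ℝ :=
  ζ.1 * poly N a ((2 : ℝ) ^ (-j) * t) + ζ.2 * v * (2 : ℝ) ^ (-j) * t

/-- The oscillatory integral `∫ e(φ_{j,ξ,η,x}(t)) ρ_σ(t) dt` with `ρ_σ(t) = θ_σ(t) / t`. -/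
def oscillatory (θ : ℝ → ℝ) (N : ℕ) (a : ℕ → ℝ) (σ : ℤˣ) (j : ℤ) (v : ℝ) (ζ : ℝ × ℝ) : ℂ :=
  ∫ t : ℝ, e (phase N a j v ζ t) * ((signed θ σ t / t : ℝ) : ℂ)

/-- The symbol `M_{j,m}(ξ, η)` of the diagonal frequency piece at scale `j`, where `v` stands for
`u(x)`; `Φ` is the frequency cutoff on the positive half-line, `σ 0`, `σ 1`, `σ 2` are the signs of
`ξ`, `η`, `u(x)`, and `σ 3` is the sign of `t`. For given `v` and `(ξ, η)` only finitely many `k`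
contribute. -/
def symbol (θ Φ : ℝ → ℝ) (N l : ℕ) (a : ℕ → ℝ) (σ : Fin 4 → ℤˣ) (m : ℕ) (j : ℤ) (v : ℝ)
    (ζ : ℝ × ℝ) : ℂ :=
  ∑' k : ℤ,
    ((signed Φ (σ 0) (ζ.1 / (2 : ℝ) ^ (j * (l : ℤ) + (m : ℤ))) *
      signed Φ (σ 1) (ζ.2 / (2 : ℝ) ^ k) *
      signed Φ (σ 2) (v / (2 : ℝ) ^ (j - k + (m : ℤ))) : ℝ) : ℂ) *
    oscillatory θ N a (σ 3) j v ζ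

/-- The operator
`ℋ_m f(x, y) = ∫ f̂(ξ, η) e(ξ x + η y) ∑_{j ∈ S_l} M_{j,m}(ξ, η) dξ dη`.
For a Schwartz function `f` the integral converges absolutely, and for given `x`, `ξ`, `η` only
finitely many `j` contribute to the sum. -/
def highFreq (θ Φ : ℝ → ℝ) (N l : ℕ) (K : ℝ) (a : ℕ → ℝ) (u : ℝ → ℝ) (σ : Fin 4 → ℤˣ) (m : ℕ)
    (f : ℝ × ℝ → ℂ) (z : ℝ × ℝ) : ℂ :=
  ∫ ζ : ℝ × ℝ, fourier f ζ * e (ζ.1 * z.1 + ζ.2 * z.2) *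
    ∑' j : dominatingSet N K a l, symbol θ Φ N l a σ m (j : ℤ) (u z.1) ζ

end

end PolyHilbert

/-! Since `u` depends on `x` only, for fixed `x` the operator is a Fourier multiplier in `y`.
Plancherel in `y` therefore reduces the claim to operators in `x` alone, with `η` frozen, whose
squared `L²` norm must be `O(2^{-m/2})` uniformly in `η` (`exists_fiber_bound`).

The scales decouple. The cutoffs in `η` and `u(x)` force `|η u(x)| ≈ 2^{j+m}`, so at a given `x` at
most five `j` contribute, and the cutoffs in `ξ` at height `2^{jl+m}` overlap boundedly.
Cauchy–Schwarz over the active scales leaves a single-scale estimate.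

At one scale, inverting the Fourier transform in `ξ` gives `g ↦ W(x) ∫ ρ(t) e(v(x) t) g(x + P(2^{-j}
t)) dt` with `v(x) = η u(x) 2^{-j}`, and `|v(x)| ≥ Λ = 2^m / 4` wherever `W(x) ≠ 0`. A dilation in
`x` turns `P(2^{-j} t)` into `p(t)`, a small perturbation of `t^l`. The kernel of `T T*` at `(x, y)`
is, with `X = x - y`, an oscillatory integral of phase `v(x) t - v(y) S(t)`, where `p(S(t)) = p(t) +
X`. Its second derivative is `-v(y) S''(t)`: the arbitrary number `v(x)` disappears, so
measurability of `u` suffices. Moreover `|S''| ≳ |X|`, because `p''/(p')²` has nonvanishing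
derivative; for `t^l` this amounts to `2p''² - p'''p' = l³(l-1) t^{2l-4} ≠ 0`, which is where `l ≥
2` enters (`curvature_lower`, `monomial_curvature`).

The second derivative test bounds the kernel by a multiple of `(Λ|X|)^{-1/2}` on a bounded range of
`X` (`norm_correlation_le`). This is integrable in `X`, and Schur's test yields `‖T T*‖ ≲ Λ^{-1/2}`
(`IsCurved.lintegral_sq_le`), the required decay. -/

namespace PolyHilbert

/-! ### The character `e` -/

lemma e_eq (x : ℝ) : e x = Complex.exp (((2 * Real.pi * x : ℝ) : ℂ) * Complex.I) := by
  unfold e; push_cast; congr 1; ring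

@[simp] lemma norm_e (x : ℝ) : ‖e x‖ = 1 := by
  rw [e_eq, Complex.norm_exp_ofReal_mul_I]

lemma e_add (x y : ℝ) : e (x + y) = e x * e y := by
  unfold e; rw [← Complex.exp_add]; congr 1; push_cast; ring

lemma conj_e (x : ℝ) : (starRingEnd ℂ) (e x) = e (-x) := by
  rw [e_eq, e_eq, ← Complex.exp_conj]; congr 1
  rw [map_mul, Complex.conj_I, Complex.conj_ofReal]; push_cast; ring

lemma continuous_e : Continuous e := by
  unfold e; fun_prop

lemma hasDerivAt_e_comp {φ : ℝ → ℝ} {d t : ℝ} (h : HasDerivAt φ d t) :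
    HasDerivAt (fun s => e (φ s)) (2 * Real.pi * Complex.I * d * e (φ t)) t := by
  unfold e
  have h1 := (h.ofReal_comp.const_mul (2 * Real.pi * Complex.I)).cexp
  convert h1 using 1
  ring

lemma fourierChar_eq_e (x : ℝ) : ((Real.fourierChar x : Circle) : ℂ) = e x := by
  rw [Real.fourierChar_apply, e_eq]

/-! ### Van der Corput's second derivative test -/

/-- Second derivative test of van der Corput with an amplitude. -/
theorem vanDerCorput_of_pos {α β lam A A' : ℝ} (hαβ : α ≤ β) (hlam : 0 < lam)
    {φ φ1 φ2 a a1 : ℝ → ℝ}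
    (hφ : ContinuousOn φ (Set.Icc α β)) (hφ1 : ContinuousOn φ1 (Set.Icc α β))
    (hφ2 : ContinuousOn φ2 (Set.Icc α β)) (ha : ContinuousOn a (Set.Icc α β))
    (ha1 : ContinuousOn a1 (Set.Icc α β))
    (dφ : ∀ t ∈ Set.Ioo α β, HasDerivAt φ (φ1 t) t)
    (dφ1 : ∀ t ∈ Set.Ioo α β, HasDerivAt φ1 (φ2 t) t)
    (da : ∀ t ∈ Set.Ioo α β, HasDerivAt a (a1 t) t)
    (hbig : ∀ t ∈ Set.Icc α β, lam ≤ φ2 t)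
    (hAb : ∀ t ∈ Set.Icc α β, |a t| ≤ A) (hAb1 : ∀ t ∈ Set.Icc α β, |a1 t| ≤ A') :
    ‖∫ t in α..β, e (φ t) * (a t : ℂ)‖ ≤ (40 * A + A' * (β - α)) / Real.sqrt lam := by
  set μ := Real.sqrt lam with hμ
  have hμ0 : 0 < μ := Real.sqrt_pos.2 hlam
  have hμ2 : μ ^ 2 = lam := Real.sq_sqrt hlam.le
  have hA : 0 ≤ A := (abs_nonneg _).trans (hAb α ⟨le_rfl, hαβ⟩)
  have hA' : 0 ≤ A' := (abs_nonneg _).trans (hAb1 α ⟨le_rfl, hαβ⟩)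
  -- Integration by parts would use `a / φ'`, singular at zeros of `φ'`. With `φ' / (φ'² + μ²)` in
  -- place of `1 / φ'` the boundary function `F = e(φ) b` is `O(A/μ)`, and the error `2πi e(φ) a -
  -- F'` is controlled by `φ'' / (φ'² + μ²)`, the derivative of `μ⁻¹ arctan(φ'/μ)`. No splitting of
  -- the interval is needed.
  set D : ℝ → ℝ := fun t => φ1 t ^ 2 + μ ^ 2 with hD
  have hD0 : ∀ t, 0 < D t := fun t => by positivity
  set b : ℝ → ℝ := fun t => a t * φ1 t / D t with hb
  set b1 : ℝ → ℝ := fun t => ((a1 t * φ1 t + a t * φ2 t) * D t - a t * φ1 t * (2 * φ1 t * φ2 t)) /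
    D t ^ 2 with hb1
  set F : ℝ → ℂ := fun t => e (φ t) * (b t : ℂ) with hF
  set F1 : ℝ → ℂ := fun t => 2 * Real.pi * Complex.I * φ1 t * e (φ t) * (b t : ℂ) +
    e (φ t) * (b1 t : ℂ) with hF1
  have hDc : ContinuousOn D (Set.Icc α β) := by fun_prop
  have hbc : ContinuousOn b (Set.Icc α β) := (ha.mul hφ1).div hDc fun t _ => (hD0 t).ne'
  have hb1c : ContinuousOn b1 (Set.Icc α β) :=
    ContinuousOn.div (by fun_prop) (by fun_prop) fun t _ => (pow_pos (hD0 t) 2).ne'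
  have hec : ContinuousOn (fun t => e (φ t)) (Set.Icc α β) :=
    continuous_e.comp_continuousOn hφ
  have cc : ∀ {f : ℝ → ℝ}, ContinuousOn f (Set.Icc α β) →
      ContinuousOn (fun t => (f t : ℂ)) (Set.Icc α β) := fun hf =>
    Complex.continuous_ofReal.comp_continuousOn hf
  have hbc' := cc hbc
  have hb1c' := cc hb1c
  have hφ1c' := cc hφ1
  have hac' := cc ha
  have hFc : ContinuousOn F (Set.Icc α β) := hec.mul hbc'
  have hF1c : ContinuousOn F1 (Set.Icc α β) := by
    simp only [hF1]; fun_prop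
  have ii : ∀ {f : ℝ → ℂ}, ContinuousOn f (Set.Icc α β) → IntervalIntegrable f volume α β :=
    fun hf => ContinuousOn.intervalIntegrable (by rwa [Set.uIcc_of_le hαβ])
  have dF : ∀ t ∈ Set.Ioo α β, HasDerivAt F (F1 t) t := by
    intro t ht
    have hDd : HasDerivAt D (2 * φ1 t * φ2 t) t := by
      have := ((dφ1 t ht).pow 2).add_const (μ ^ 2)
      exact HasDerivAt.congr_deriv this (by push_cast; ring)
    have hbd : HasDerivAt b (b1 t) t := ((da t ht).mul (dφ1 t ht)).div hDd (hD0 t).ne'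
    exact (hasDerivAt_e_comp (dφ t ht)).mul hbd.ofReal_comp
  have ftc : ∫ t in α..β, F1 t = F β - F α :=
    intervalIntegral.integral_eq_sub_of_hasDerivAt_of_le hαβ hFc dF (ii hF1c)
  -- An antiderivative of the pointwise error bound `G`. The factor 9 is 8 (from `2π ≤ 8`, using `μ²
  -- ≤ φ''`) plus 1 (from the term of `b'` containing `φ''`).
  set H : ℝ → ℝ := fun t => μ⁻¹ * Real.arctan (φ1 t / μ) * (9 * A) + A' / (2 * μ) * t with hH
  set G : ℝ → ℝ := fun t => φ2 t / D t * (9 * A) + A' / (2 * μ) with hG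
  have hGc : ContinuousOn G (Set.Icc α β) :=
    ((hφ2.div hDc fun t _ => (hD0 t).ne').mul continuousOn_const).add continuousOn_const
  have dH : ∀ t ∈ Set.Ioo α β, HasDerivAt H (G t) t := by
    intro t ht
    have h1 := (((dφ1 t ht).div_const μ).arctan.const_mul μ⁻¹).mul_const (9 * A)
    have h2 := (hasDerivAt_id t).const_mul (A' / (2 * μ))
    refine HasDerivAt.congr_deriv (h1.add h2) ?_
    simp only [hG, hD]
    have : 1 + (φ1 t / μ) ^ 2 ≠ 0 := by positivity
    have : φ1 t ^ 2 + μ ^ 2 ≠ 0 := by positivity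
    field_simp
    ring
  have hHc : ContinuousOn H (Set.Icc α β) := by
    simp only [hH]
    have : ContinuousOn (fun t => Real.arctan (φ1 t / μ)) (Set.Icc α β) :=
      Real.continuous_arctan.comp_continuousOn (hφ1.div_const μ)
    fun_prop
  have hGi : IntervalIntegrable G volume α β :=
    ContinuousOn.intervalIntegrable (by rwa [Set.uIcc_of_le hαβ])
  have ftcH : ∫ t in α..β, G t = H β - H α :=
    intervalIntegral.integral_eq_sub_of_hasDerivAt_of_le hαβ hHc dH hGi
  have hsplit : (2 * Real.pi * Complex.I) * ∫ t in α..β, e (φ t) * (a t : ℂ) =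
      (F β - F α) + ∫ t in α..β, (2 * Real.pi * Complex.I * (e (φ t) * (a t : ℂ)) - F1 t) := by
    rw [intervalIntegral.integral_sub, ftc, intervalIntegral.integral_const_mul]
    · ring
    · exact ii (by fun_prop)
    · exact ii hF1c
  have key : ∀ t ∈ Set.Icc α β, |φ1 t| / D t ≤ 1 / (2 * μ) := by
    intro t _
    rw [div_le_div_iff₀ (hD0 t) (by positivity)]
    nlinarith [sq_nonneg (|φ1 t| - μ), sq_abs (φ1 t)]
  have hR : ∀ t ∈ Set.Icc α β, ‖2 * Real.pi * Complex.I * (e (φ t) * (a t : ℂ)) - F1 t‖ ≤ G t := by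
    intro t ht
    have hDt := hD0 t
    have h1 : 2 * Real.pi * Complex.I * (e (φ t) * (a t : ℂ)) - F1 t =
        e (φ t) * (2 * Real.pi * Complex.I * ((a t * (μ ^ 2 / D t) : ℝ) : ℂ) - (b1 t : ℂ)) := by
      simp only [hF1]
      have : (b t : ℂ) * φ1 t = ((a t - a t * (μ ^ 2 / D t) : ℝ) : ℂ) := by
        rw [← Complex.ofReal_mul]; congr 1
        simp only [hb]; field_simp; simp only [hD]; ring
      have h3 : 2 * Real.pi * Complex.I * φ1 t * e (φ t) * (b t : ℂ) =
        2 * Real.pi * Complex.I * e (φ t) * ((b t : ℂ) * φ1 t) := by ring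
      rw [h3, this]; push_cast; ring
    rw [h1, norm_mul, norm_e, one_mul]
    have hbb : b1 t = a1 t * (φ1 t / D t) + a t * (φ2 t / D t) * ((μ ^ 2 - φ1 t ^ 2) / D t) := by
      simp only [hb1]; field_simp; simp only [hD]; ring
    have hφ2p : 0 ≤ φ2 t := hlam.le.trans (hbig t ht)
    have hq : |(μ ^ 2 - φ1 t ^ 2) / D t| ≤ 1 := by
      rw [abs_div, abs_of_pos hDt, div_le_one hDt, abs_le]
      constructor <;> simp only [hD] <;> nlinarith [sq_nonneg (φ1 t), sq_nonneg μ]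
    have hb1b : |b1 t| ≤ A' / (2 * μ) + A * (φ2 t / D t) := by
      rw [hbb]
      refine (abs_add_le _ _).trans (add_le_add ?_ ?_)
      · rw [abs_mul, abs_div, abs_of_pos hDt]
        calc _ ≤ A' * (1 / (2 * μ)) := mul_le_mul (hAb1 t ht) (key t ht) (by positivity) hA'
          _ = _ := by ring
      · rw [abs_mul, abs_mul, abs_div, abs_of_pos hDt, abs_of_nonneg hφ2p]
        calc _ ≤ A * (φ2 t / D t) * 1 := by
              gcongr
              exact hAb t ht
          _ = _ := by ring
    have ha2 : |a t * (μ ^ 2 / D t)| ≤ A * (φ2 t / D t) := by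
      rw [abs_mul, abs_of_nonneg (a := μ ^ 2 / D t) (by positivity), hμ2]
      gcongr
      · exact hAb t ht
      · exact hbig t ht
    refine (norm_sub_le _ _).trans ?_
    rw [norm_mul, norm_mul, norm_mul, Complex.norm_I, Complex.norm_real, Complex.norm_real,
      Complex.norm_real, Real.norm_eq_abs, Real.norm_eq_abs, Real.norm_eq_abs,
      abs_of_pos Real.pi_pos, Complex.norm_ofNat, mul_one]
    have hpi := Real.pi_lt_four
    have h5 : 2 * Real.pi * |a t * (μ ^ 2 / D t)| ≤ 8 * (A * (φ2 t / D t)) :=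
      mul_le_mul (by linarith) ha2 (abs_nonneg _) (by norm_num)
    simp only [hG]
    linarith
  have hint : ‖∫ t in α..β, (2 * Real.pi * Complex.I * (e (φ t) * (a t : ℂ)) - F1 t)‖ ≤
      H β - H α := by
    rw [← ftcH]
    exact intervalIntegral.norm_integral_le_of_norm_le hαβ
      (Filter.Eventually.of_forall fun t ht => hR t ⟨ht.1.le, ht.2⟩) hGi
  have hFb : ∀ t ∈ Set.Icc α β, ‖F t‖ ≤ A / (2 * μ) := by
    intro t ht
    simp only [hF, hb]
    rw [norm_mul, norm_e, one_mul, Complex.norm_real, Real.norm_eq_abs, mul_div_assoc, abs_mul,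
      abs_div, abs_of_pos (hD0 t)]
    calc _ ≤ A * (1 / (2 * μ)) := mul_le_mul (hAb t ht) (key t ht) (by positivity) hA
      _ = _ := by ring
  have hHb : H β - H α ≤ 9 * A * (4 / μ) + A' * (β - α) / (2 * μ) := by
    have h1 := Real.arctan_lt_pi_div_two (φ1 β / μ)
    have h2 := Real.neg_pi_div_two_lt_arctan (φ1 α / μ)
    have hpi := Real.pi_lt_four
    have : H β - H α = 9 * A * ((Real.arctan (φ1 β / μ) - Real.arctan (φ1 α / μ)) / μ) +
        A' * (β - α) / (2 * μ) := by
      simp only [hH]; ring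
    rw [this]
    gcongr
    linarith
  have hn : ‖(2 * Real.pi * Complex.I) * ∫ t in α..β, e (φ t) * (a t : ℂ)‖ ≤
      (40 * A + A' * (β - α)) / μ := by
    rw [hsplit]
    calc _ ≤ (‖F β‖ + ‖F α‖) + (H β - H α) :=
          (norm_add_le _ _).trans (add_le_add (norm_sub_le _ _) hint)
      _ ≤ A / (2 * μ) + A / (2 * μ) + (9 * A * (4 / μ) + A' * (β - α) / (2 * μ)) := by
          gcongr
          · exact hFb β ⟨hαβ, le_rfl⟩
          · exact hFb α ⟨le_rfl, hαβ⟩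
      _ = (37 * A + A' * (β - α) / 2) / μ := by field_simp; ring
      _ ≤ _ := by
          gcongr
          · norm_num
          · have : 0 ≤ A' * (β - α) := mul_nonneg hA' (by linarith)
            linarith
  rw [norm_mul, norm_mul, norm_mul, Complex.norm_I, Complex.norm_real, Real.norm_eq_abs,
    abs_of_pos Real.pi_pos, Complex.norm_ofNat, mul_one] at hn
  refine le_trans ?_ hn
  have := Real.pi_gt_three
  exact le_mul_of_one_le_left (norm_nonneg _) (by linarith)

/-- Second derivative test of van der Corput with an amplitude. -/
theorem vanDerCorput {α β lam A A' : ℝ} (hαβ : α ≤ β) (hlam : 0 < lam)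
    {φ φ1 φ2 a a1 : ℝ → ℝ}
    (hφ : ContinuousOn φ (Set.Icc α β)) (hφ1 : ContinuousOn φ1 (Set.Icc α β))
    (hφ2 : ContinuousOn φ2 (Set.Icc α β)) (ha : ContinuousOn a (Set.Icc α β))
    (ha1 : ContinuousOn a1 (Set.Icc α β))
    (dφ : ∀ t ∈ Set.Ioo α β, HasDerivAt φ (φ1 t) t)
    (dφ1 : ∀ t ∈ Set.Ioo α β, HasDerivAt φ1 (φ2 t) t)
    (da : ∀ t ∈ Set.Ioo α β, HasDerivAt a (a1 t) t)
    (hbig : ∀ t ∈ Set.Icc α β, lam ≤ |φ2 t|)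
    (hAb : ∀ t ∈ Set.Icc α β, |a t| ≤ A) (hAb1 : ∀ t ∈ Set.Icc α β, |a1 t| ≤ A') :
    ‖∫ t in α..β, e (φ t) * (a t : ℂ)‖ ≤ (40 * A + A' * (β - α)) / Real.sqrt lam := by
  have hα : α ∈ Set.Icc α β := ⟨le_rfl, hαβ⟩
  -- A continuous function with `|φ''| ≥ lam > 0` cannot change sign on an interval. The negative
  -- case follows by complex conjugation.
  have hsign : (∀ t ∈ Set.Icc α β, 0 < φ2 t) ∨ (∀ t ∈ Set.Icc α β, φ2 t < 0) := by
    by_contra! h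
    obtain ⟨⟨s, hs, hs1⟩, ⟨t, ht, ht1⟩⟩ := h
    have h0 : (0 : ℝ) ∈ φ2 '' Set.Icc α β :=
      (isPreconnected_Icc.image _ hφ2).ordConnected.out ⟨s, hs, rfl⟩ ⟨t, ht, rfl⟩ ⟨hs1, ht1⟩
    obtain ⟨r, hr, hr0⟩ := h0
    have := hbig r hr
    rw [hr0, abs_zero] at this
    linarith
  rcases hsign with hp | hn
  · exact vanDerCorput_of_pos hαβ hlam hφ hφ1 hφ2 ha ha1 dφ dφ1 da
      (fun t ht => (hbig t ht).trans_eq (abs_of_pos (hp t ht))) hAb hAb1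
  · have h := vanDerCorput_of_pos hαβ hlam hφ.neg hφ1.neg hφ2.neg ha ha1
      (fun t ht => (dφ t ht).neg) (fun t ht => (dφ1 t ht).neg) da
      (fun t ht => (hbig t ht).trans_eq (abs_of_neg (hn t ht))) hAb hAb1
    refine le_of_eq_of_le ?_ h
    rw [← RCLike.norm_conj]
    congr 1
    rw [← intervalIntegral.intervalIntegral_conj]
    simp [conj_e]

/-! ### Plancherel on the line -/

lemma continuous_integral_mul_e {G : ℝ → ℂ} (h1 : Integrable G) :
    Continuous fun y => ∫ η, G η * e (η * y) := by
  refine continuous_of_dominated (bound := fun η => ‖G η‖) ?_ ?_ h1.norm ?_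
  · intro y
    exact h1.1.mul (continuous_e.comp (by fun_prop)).aestronglyMeasurable
  · intro y; filter_upwards with η; simp
  · filter_upwards with η
    exact continuous_const.mul (continuous_e.comp (by fun_prop))

lemma lintegral_sq_eq_eLpNorm_sq {X : Type*} [MeasurableSpace X] {μ : Measure X} (h : X → ℂ) :
    ∫⁻ x, ‖h x‖ₑ ^ 2 ∂μ = eLpNorm h 2 μ ^ 2 := by
  have := eLpNorm_nnreal_pow_eq_lintegral (f := h) (μ := μ) (p := 2) (by norm_num)
  simpa using this.symm

open FourierTransform in
/-- Plancherel's inequality for functions in `L¹ ∩ L²`. -/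
theorem lintegral_fourierInv_sq_le {G : ℝ → ℂ} (h1 : Integrable G) (h2 : MemLp G 2) :
    ∫⁻ y, ‖∫ η, G η * e (η * y)‖ₑ ^ 2 ≤ ∫⁻ η, ‖G η‖ₑ ^ 2 := by
  set E : ℝ → ℂ := fun y => ∫ η, G η * e (η * y) with hE
  have hEc : Continuous E := continuous_integral_mul_e h1
  set f : Lp ℂ 2 (volume : Measure ℝ) := h2.toLp G with hf
  -- The absolutely convergent integral `E` is identified with the `L²` inverse transform by pairing
  -- both with test functions: duality moves the transform onto the test function, and Fubini moves
  -- it back.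
  have hae : ∀ᵐ y, E y = (𝓕⁻ f : Lp ℂ 2 (volume : Measure ℝ)) y := by
    apply ae_eq_of_integral_contDiff_smul_eq hEc.locallyIntegrable
      ((Lp.memLp _).locallyIntegrable (by norm_num))
    intro g hg hgs
    have hs1 : HasCompactSupport (fun x => (g x : ℂ)) := hgs.comp_left Complex.ofReal_zero
    have hs2 : ContDiff ℝ ∞ (fun x => (g x : ℂ)) := Complex.ofRealCLM.contDiff.comp hg
    set g' : 𝓢(ℝ, ℂ) := hs1.toSchwartzMap hs2 with hg'
    have hgg : ∀ x, g' x = (g x : ℂ) := fun x => rfl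
    have hd := congrArg (fun T => T g') (Lp.fourierInv_toTemperedDistribution_eq f)
    simp only [TemperedDistribution.fourierInv_apply, Lp.toTemperedDistribution_apply] at hd
    have hr : ∫ x, g x • (𝓕⁻ f : Lp ℂ 2 (volume : Measure ℝ)) x =
        ∫ x, g' x • (𝓕⁻ f : Lp ℂ 2 (volume : Measure ℝ)) x := by
      simp [hgg]
    rw [hr, ← hd]
    have hl : ∫ x, (𝓕⁻ g') x • f x = ∫ x, (𝓕⁻ g') x * G x := by
      apply integral_congr_ae
      filter_upwards [h2.coeFn_toLp] with x hx
      rw [hf, hx, smul_eq_mul]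
    rw [hl]
    have hfi : ∀ x, (𝓕⁻ g') x = ∫ y, (g y : ℂ) * e (x * y) := by
      intro x
      rw [SchwartzMap.fourierInv_coe, Real.fourierInv_eq]
      congr 1; ext y
      rw [Circle.smul_def, fourierChar_eq_e, smul_eq_mul, hgg, mul_comm]
      simp
    simp_rw [hfi, hE, Complex.real_smul, ← integral_const_mul, ← integral_mul_const]
    rw [integral_integral_swap]
    · congr 1; ext x; congr 1; ext y; ring
    · have := (g'.integrable (μ := volume)).mul_prod h1
      have h3 : Integrable (fun z : ℝ × ℝ => (g' z.1 * G z.2) * e (z.2 * z.1))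
          (volume.prod volume) :=
        this.mul_bdd (c := 1) (continuous_e.comp (by fun_prop)).aestronglyMeasurable
          (Filter.Eventually.of_forall fun z => by simp)
      refine h3.congr (Filter.Eventually.of_forall fun z => ?_)
      simp [Function.uncurry, hgg, mul_assoc]
  have hnorm : ‖(𝓕⁻ f : Lp ℂ 2 (volume : Measure ℝ))‖ₑ = ‖f‖ₑ := by
    have h := Lp.norm_fourier_eq (𝓕⁻ f : Lp ℂ 2 (volume : Measure ℝ))
    rw [fourier_fourierInv_eq] at h
    rw [← ofReal_norm, ← ofReal_norm, h]
  rw [lintegral_sq_eq_eLpNorm_sq, lintegral_sq_eq_eLpNorm_sq, eLpNorm_congr_ae hae, ← Lp.enorm_def, hnorm, hf, Lp.enorm_toLp]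

/-! ### The `T T*` method -/

section TTStar

variable {X Y : Type*} [MeasurableSpace X] [MeasurableSpace Y] {μ : Measure X} {ν : Measure Y}

set_option maxHeartbeats 800000 in
/-- The `T T*` method together with Schur's test, for a bounded kernel on finite measure spaces. -/
theorem integral_normSq_le_of_ttstar [IsFiniteMeasure μ] [IsFiniteMeasure ν] {k : X → Y → ℂ}
    (hk : Measurable (Function.uncurry k)) {M : ℝ} (hM : ∀ x z, ‖k x z‖ ≤ M) {B : ℝ} (hB0 : 0 < B)
    (hB : ∀ x, ∫ y, ‖∫ z, k x z * (starRingEnd ℂ) (k y z) ∂ν‖ ∂μ ≤ B)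
    {g : Y → ℂ} (hg : Measurable g) {Mg : ℝ} (hMg : ∀ z, ‖g z‖ ≤ Mg) :
    ∫ x, ‖∫ z, k x z * g z ∂ν‖ ^ 2 ∂μ ≤ B * ∫ z, ‖g z‖ ^ 2 ∂ν := by
  set F : X → ℂ := fun x => ∫ z, k x z * g z ∂ν with hF
  have hFm : Measurable F := by
    have : Measurable (Function.uncurry fun x z => k x z * g z) :=
      hk.mul (hg.comp measurable_snd)
    exact (this.stronglyMeasurable.integral_prod_right (ν := ν)).measurable
  rcases isEmpty_or_nonempty X with hX | ⟨⟨x₀⟩⟩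
  · rw [Measure.eq_zero_of_isEmpty μ, integral_zero_measure]
    exact mul_nonneg hB0.le (integral_nonneg fun _ => by positivity)
  rcases isEmpty_or_nonempty Y with hY | ⟨⟨z₀⟩⟩
  · simp [Measure.eq_zero_of_isEmpty ν]
  have hM0 : 0 ≤ M := (norm_nonneg _).trans (hM x₀ z₀)
  have hMg0 : 0 ≤ Mg := (norm_nonneg _).trans (hMg z₀)
  set MF : ℝ := M * Mg * ν.real Set.univ with hMF
  have hFb : ∀ x, ‖F x‖ ≤ MF := by
    intro x
    refine norm_integral_le_of_norm_le_const (Filter.Eventually.of_forall fun z => ?_)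
    rw [norm_mul]
    exact mul_le_mul (hM x z) (hMg z) (norm_nonneg _) hM0
  have hMF0 : 0 ≤ MF := (norm_nonneg _).trans (hFb x₀)
  set K : X → X → ℂ := fun x y => ∫ z, k x z * (starRingEnd ℂ) (k y z) ∂ν with hK
  have hconj : Measurable (starRingEnd ℂ) := Complex.continuous_conj.measurable
  have hKm : Measurable (Function.uncurry K) := by
    have : Measurable (Function.uncurry fun (q : X × X) z =>
        k q.1 z * (starRingEnd ℂ) (k q.2 z)) :=
      (hk.comp (by fun_prop : Measurable fun q : (X × X) × Y => (q.1.1, q.2))).mul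
        (hconj.comp (hk.comp (by fun_prop : Measurable fun q : (X × X) × Y => (q.1.2, q.2))))
    exact (this.stronglyMeasurable.integral_prod_right (ν := ν)).measurable
  have hKb : ∀ x y, ‖K x y‖ ≤ M * M * ν.real Set.univ := by
    intro x y
    refine norm_integral_le_of_norm_le_const (Filter.Eventually.of_forall fun z => ?_)
    rw [norm_mul, RCLike.norm_conj]
    exact mul_le_mul (hM x z) (hM y z) (norm_nonneg _) hM0
  have hKsymm : ∀ x y, ‖K x y‖ = ‖K y x‖ := by
    intro x y
    rw [← RCLike.norm_conj]
    simp only [hK]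
    rw [← integral_conj]
    congr 2; ext z; simp [mul_comm]
  set H : Y → ℂ := fun z => ∫ x, (starRingEnd ℂ) (F x) * k x z ∂μ with hH
  have hp : Measurable (Function.uncurry fun z x => (starRingEnd ℂ) (F x) * k x z) :=
    (hconj.comp (hFm.comp measurable_snd)).mul (hk.comp measurable_swap)
  have hpb : ∀ x z, ‖(starRingEnd ℂ) (F x) * k x z‖ ≤ MF * M := by
    intro x z
    rw [norm_mul, RCLike.norm_conj]
    exact mul_le_mul (hFb x) (hM x z) (norm_nonneg _) hMF0
  have hHm : Measurable H := (hp.stronglyMeasurable.integral_prod_right (ν := μ)).measurable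
  have hHb : ∀ z, ‖H z‖ ≤ MF * M * μ.real Set.univ := fun z =>
    norm_integral_le_of_norm_le_const (Filter.Eventually.of_forall fun x => hpb x z)
  set a : ℝ := ∫ x, ‖F x‖ ^ 2 ∂μ with ha
  set G : ℝ := ∫ z, ‖g z‖ ^ 2 ∂ν with hG
  have iF : Integrable (fun x => ‖F x‖ ^ 2) μ :=
    Integrable.of_bound (hFm.norm.pow_const 2).aestronglyMeasurable (MF ^ 2)
      (Filter.Eventually.of_forall fun x => by
        rw [Real.norm_of_nonneg (by positivity)]
        exact pow_le_pow_left₀ (norm_nonneg _) (hFb x) 2)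
  have ig : Integrable (fun x => ‖g x‖ ^ 2) ν :=
    Integrable.of_bound (hg.norm.pow_const 2).aestronglyMeasurable (Mg ^ 2)
      (Filter.Eventually.of_forall fun x => by
        rw [Real.norm_of_nonneg (by positivity)]
        exact pow_le_pow_left₀ (norm_nonneg _) (hMg x) 2)
  have iH : Integrable (fun x => ‖H x‖ ^ 2) ν :=
    Integrable.of_bound (hHm.norm.pow_const 2).aestronglyMeasurable
      ((MF * M * μ.real Set.univ) ^ 2)
      (Filter.Eventually.of_forall fun x => by
        rw [Real.norm_of_nonneg (by positivity)]
        exact pow_le_pow_left₀ (norm_nonneg _) (hHb x) 2)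
  -- Duality: `‖T g‖² = ⟨T g, T g⟩` is rewritten as the pairing of `g` with `H`, the conjugate of
  -- `T* T g`.
  have step1 : (a : ℂ) = ∫ z, H z * g z ∂ν := by
    have e1 : (a : ℂ) = ∫ x, ∫ z, (starRingEnd ℂ) (F x) * k x z * g z ∂ν ∂μ := by
      rw [ha, ← integral_complex_ofReal]
      congr 1; ext x
      simp_rw [mul_assoc]
      rw [integral_const_mul, Complex.ofReal_pow, ← Complex.conj_mul']
    rw [e1, integral_integral_swap]
    · simp_rw [integral_mul_const, hH]
    · refine Integrable.of_bound (C := MF * M * Mg) ?_ ?_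
      · exact ((hp.comp measurable_swap).mul (hg.comp measurable_snd)).aestronglyMeasurable
      · refine Filter.Eventually.of_forall fun q => ?_
        simp only [Function.uncurry]
        rw [norm_mul]
        exact mul_le_mul (hpb _ _) (hMg _) (norm_nonneg _) (by positivity)
  -- Schur's test: `‖H‖²` is the double integral of `conj F(x) · F(y) · K(x, y)`. By `2|F(x) F(y)| ≤
  -- |F(x)|² + |F(y)|²` and the symmetry of `|K|`, the row bound `B` is enough.
  have step2 : ∫ z, ‖H z‖ ^ 2 ∂ν ≤ B * a := by
    have e1 : ((∫ z, ‖H z‖ ^ 2 ∂ν : ℝ) : ℂ) =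
        ∫ q : X × X, (starRingEnd ℂ) (F q.1) * F q.2 * K q.1 q.2 ∂(μ.prod μ) := by
      rw [← integral_complex_ofReal]
      have e2 : ∀ z, ((‖H z‖ ^ 2 : ℝ) : ℂ) = ∫ q : X × X, ((starRingEnd ℂ) (F q.1) * k q.1 z) *
          (starRingEnd ℂ) ((starRingEnd ℂ) (F q.2) * k q.2 z) ∂(μ.prod μ) := by
        intro z
        rw [integral_prod_mul (fun x => (starRingEnd ℂ) (F x) * k x z)
          (fun x => (starRingEnd ℂ) ((starRingEnd ℂ) (F x) * k x z)), integral_conj,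
          Complex.ofReal_pow, ← Complex.mul_conj']
      simp_rw [e2]
      rw [integral_integral_swap]
      · congr 1; ext q
        simp only [hK]
        rw [← integral_const_mul]
        congr 1; ext z
        simp only [map_mul, Complex.conj_conj]; ring
      · refine Integrable.of_bound (C := (MF * M) * (MF * M)) ?_ ?_
        · exact Measurable.aestronglyMeasurable
            ((hp.comp (by fun_prop : Measurable fun q : Y × (X × X) => (q.1, q.2.1))).mul
            (hconj.comp (hp.comp (by fun_prop : Measurable fun q : Y × (X × X) => (q.1, q.2.2)))))
        · refine Filter.Eventually.of_forall fun q => ?_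
          simp only [Function.uncurry]
          rw [norm_mul, RCLike.norm_conj]
          exact mul_le_mul (hpb _ _) (hpb _ _) (norm_nonneg _) (by positivity)
    have i1 : Integrable (fun q : X × X => ‖F q.1‖ ^ 2 * ‖K q.1 q.2‖) (μ.prod μ) := by
      refine Integrable.of_bound (C := MF ^ 2 * (M * M * ν.real Set.univ)) ?_ ?_
      · exact (((hFm.comp measurable_fst).norm.pow_const 2).mul hKm.norm).aestronglyMeasurable
      · refine Filter.Eventually.of_forall fun q => ?_
        rw [Real.norm_of_nonneg (by positivity)]
        exact mul_le_mul (pow_le_pow_left₀ (norm_nonneg _) (hFb _) 2) (hKb _ _) (norm_nonneg _)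
          (by positivity)
    have i2 : Integrable (fun q : X × X => ‖F q.2‖ ^ 2 * ‖K q.1 q.2‖) (μ.prod μ) := by
      refine i1.swap.congr (Filter.Eventually.of_forall fun q => ?_)
      simp only [Function.comp, Prod.fst_swap, Prod.snd_swap]
      rw [hKsymm]
    have v1 : ∫ q : X × X, ‖F q.1‖ ^ 2 * ‖K q.1 q.2‖ ∂(μ.prod μ) ≤ B * a := by
      rw [integral_prod _ i1]
      simp_rw [integral_const_mul]
      rw [ha, ← integral_const_mul]
      refine integral_mono_of_nonneg (Filter.Eventually.of_forall fun x => ?_)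
        (iF.const_mul B) (Filter.Eventually.of_forall fun x => ?_)
      · exact mul_nonneg (by positivity) (integral_nonneg fun _ => norm_nonneg _)
      · dsimp only
        rw [mul_comm]
        exact mul_le_mul_of_nonneg_right (hB x) (by positivity)
    have v2 : ∫ q : X × X, ‖F q.2‖ ^ 2 * ‖K q.1 q.2‖ ∂(μ.prod μ) ≤ B * a := by
      rw [← integral_prod_swap]
      refine le_of_eq_of_le ?_ v1
      congr 1; ext q
      simp only [Prod.fst_swap, Prod.snd_swap]
      rw [hKsymm]
    have e3 : ∫ z, ‖H z‖ ^ 2 ∂ν = ‖((∫ z, ‖H z‖ ^ 2 ∂ν : ℝ) : ℂ)‖ := by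
      rw [Complex.norm_real, Real.norm_of_nonneg (integral_nonneg fun _ => by positivity)]
    rw [e3, e1]
    refine (norm_integral_le_of_norm_le ((i1.add i2).const_mul (1 / 2))
      (Filter.Eventually.of_forall fun q => ?_)).trans ?_
    · rw [norm_mul, norm_mul, RCLike.norm_conj]
      simp only [Pi.add_apply]
      have := mul_nonneg (sq_nonneg (‖F q.1‖ - ‖F q.2‖)) (norm_nonneg (K q.1 q.2))
      nlinarith
    · rw [integral_const_mul]
      simp only [Pi.add_apply]
      rw [integral_add i1 i2]
      linarith
  -- The weight `B` in this arithmetic–geometric mean inequality is chosen so that `step2` gives `a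
  -- ≤ a/2 + B G/2`; `a` is finite and is absorbed on the left.
  have step3 : a ≤ (1 / 2) * (B⁻¹ * ∫ z, ‖H z‖ ^ 2 ∂ν + B * G) := by
    have e3 : a = ‖(a : ℂ)‖ := by
      rw [Complex.norm_real, Real.norm_of_nonneg (integral_nonneg fun _ => by positivity)]
    rw [e3, step1]
    refine (norm_integral_le_of_norm_le (((iH.const_mul B⁻¹).add (ig.const_mul B)).const_mul (1 / 2))
      (Filter.Eventually.of_forall fun z => ?_)).trans_eq ?_
    · rw [norm_mul]
      simp only [Pi.add_apply]
      have h1 : 0 ≤ B⁻¹ * (‖H z‖ - B * ‖g z‖) ^ 2 := by positivity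
      have h2 : B⁻¹ * (‖H z‖ - B * ‖g z‖) ^ 2 =
          B⁻¹ * ‖H z‖ ^ 2 + B * ‖g z‖ ^ 2 - 2 * (‖H z‖ * ‖g z‖) := by
        field_simp; ring
      linarith
    · rw [integral_const_mul]
      simp only [Pi.add_apply]
      rw [integral_add (iH.const_mul _) (ig.const_mul _), integral_const_mul, integral_const_mul]
  have h4 : B⁻¹ * ∫ z, ‖H z‖ ^ 2 ∂ν ≤ a := by
    rw [inv_mul_le_iff₀ hB0]; exact step2
  linarith

end TTStar

/-! ### Curved phases and transported densities -/

/-- A phase `p` with three derivatives, strictly monotone (with direction `s = ±1`) near `[α, β]`,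
and with `(p''/(p')²)'` bounded away from zero. -/
structure IsCurved (p p1 p2 p3 : ℝ → ℝ) (s α₀ α β β₀ c C : ℝ) : Prop where
  sq_s : s ^ 2 = 1
  hα : α₀ < α
  hαβ : α ≤ β
  hβ : β < β₀
  c_pos : 0 < c
  deriv0 : ∀ t, HasStrictDerivAt p (p1 t) t
  deriv1 : ∀ t, HasDerivAt p1 (p2 t) t
  deriv2 : ∀ t, HasDerivAt p2 (p3 t) t
  lower : ∀ t ∈ Set.Ioo α₀ β₀, c ≤ s * p1 t
  upper1 : ∀ t ∈ Set.Icc α β, |p1 t| ≤ C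
  upper2 : ∀ t ∈ Set.Icc α β, |p2 t| ≤ C
  curv : ∀ t ∈ Set.Icc α β, c ≤ |2 * p2 t ^ 2 - p3 t * p1 t|

lemma exists_mvt {f f' : ℝ → ℝ} {I : Set ℝ} (hI : I.OrdConnected)
    (hf : ∀ t ∈ I, HasDerivAt f (f' t) t) {x y : ℝ} (hx : x ∈ I) (hy : y ∈ I) :
    ∃ z ∈ I, f y - f x = f' z * (y - x) := by
  wlog hxy : x < y generalizing x y
  · rcases eq_or_lt_of_le (not_lt.1 hxy) with rfl | hlt
    · exact ⟨y, hy, by simp⟩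
    · obtain ⟨z, hz, h⟩ := this hy hx hlt
      exact ⟨z, hz, by linarith⟩
  have hsub : Set.Icc x y ⊆ I := hI.out hx hy
  obtain ⟨z, hz, h⟩ := exists_hasDerivAt_eq_slope f f' hxy
    (fun t ht => (hf t (hsub ht)).continuousAt.continuousWithinAt)
    (fun t ht => hf t (hsub (Set.Ioo_subset_Icc_self ht)))
  refine ⟨z, hsub (Set.Ioo_subset_Icc_self hz), ?_⟩
  rw [h]
  field_simp [(sub_pos.2 hxy).ne']

noncomputable section

/-- The branch on `(α₀, β₀)` of the inverse of a phase `p`. -/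
def branch (p : ℝ → ℝ) (α₀ β₀ : ℝ) : ℝ → ℝ := Function.invFunOn p (Set.Ioo α₀ β₀)

/-- The density of the measure `e(v t) ρ(t) dt` on `[α, β]` transported by `p`. -/
def pushKernel (p p1 ρ : ℝ → ℝ) (s α₀ α β β₀ v r : ℝ) : ℂ :=
  (p '' Set.Icc α β).indicator (fun r => e (v * branch p α₀ β₀ r) *
    ((ρ (branch p α₀ β₀ r) / (s * p1 (branch p α₀ β₀ r)) : ℝ) : ℂ)) r

end

namespace IsCurved

variable {p p1 p2 p3 : ℝ → ℝ} {s α₀ α β β₀ c C : ℝ} (h : IsCurved p p1 p2 p3 s α₀ α β β₀ c C)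
include h

lemma Icc_subset : Set.Icc α β ⊆ Set.Ioo α₀ β₀ := fun _ ht =>
  ⟨h.hα.trans_le ht.1, ht.2.trans_lt h.hβ⟩

lemma abs_s : |s| = 1 := by
  have h1 := h.sq_s
  rw [← sq_abs] at h1
  nlinarith [abs_nonneg s]

lemma s_ne : s ≠ 0 := by
  intro h0; have := h.abs_s; simp [h0] at this

lemma abs_p1 {t : ℝ} (ht : t ∈ Set.Ioo α₀ β₀) : |p1 t| = s * p1 t := by
  have h1 := h.lower t ht
  rw [← abs_of_pos (h.c_pos.trans_le h1), abs_mul, h.abs_s, one_mul]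

lemma lower_abs {t : ℝ} (ht : t ∈ Set.Ioo α₀ β₀) : c ≤ |p1 t| := by
  rw [h.abs_p1 ht]; exact h.lower t ht

lemma p1_ne {t : ℝ} (ht : t ∈ Set.Ioo α₀ β₀) : p1 t ≠ 0 := by
  have := h.lower_abs ht
  intro h0
  rw [h0, abs_zero] at this
  exact absurd h.c_pos (not_lt.2 this)

lemma C_pos : 0 < C :=
  h.c_pos.trans_le ((h.lower_abs (h.Icc_subset ⟨le_rfl, h.hαβ⟩)).trans
    (h.upper1 α ⟨le_rfl, h.hαβ⟩))

lemma continuous_p : Continuous p :=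
  continuous_iff_continuousAt.2 fun t => (h.deriv0 t).hasDerivAt.continuousAt

lemma continuous_p1 : Continuous p1 :=
  continuous_iff_continuousAt.2 fun t => (h.deriv1 t).continuousAt

lemma continuous_p2 : Continuous p2 :=
  continuous_iff_continuousAt.2 fun t => (h.deriv2 t).continuousAt

lemma injOn : Set.InjOn p (Set.Ioo α₀ β₀) := by
  intro x hx y hy hxy
  obtain ⟨z, hz, h1⟩ := exists_mvt Set.ordConnected_Ioo (fun t _ => (h.deriv0 t).hasDerivAt) hx hy
  rw [hxy, sub_self, eq_comm, mul_eq_zero] at h1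
  rcases h1 with h1 | h1
  · exact absurd h1 (h.p1_ne hz)
  · linarith

lemma branch_apply {t : ℝ} (ht : t ∈ Set.Ioo α₀ β₀) : branch p α₀ β₀ (p t) = t :=
  h.injOn.leftInvOn_invFunOn ht

lemma branch_mem {r : ℝ} (hr : r ∈ p '' Set.Icc α β) :
    branch p α₀ β₀ r ∈ Set.Icc α β ∧ p (branch p α₀ β₀ r) = r := by
  obtain ⟨t, ht, rfl⟩ := hr
  rw [h.branch_apply (h.Icc_subset ht)]
  exact ⟨ht, rfl⟩

/-- The margin between `[α, β]` and `(α₀, β₀)` is used here: `branch` inverts `p` on a full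
neighbourhood, so it has a two-sided derivative even at images of the endpoints. -/
lemma hasDerivAt_branch {r : ℝ} (hr : r ∈ p '' Set.Icc α β) :
    HasDerivAt (branch p α₀ β₀) (p1 (branch p α₀ β₀ r))⁻¹ r := by
  obtain ⟨t, ht, rfl⟩ := hr
  have ht' := h.Icc_subset ht
  rw [h.branch_apply ht']
  refine ((h.deriv0 t).to_local_left_inverse (h.p1_ne ht') ?_).hasDerivAt
  filter_upwards [isOpen_Ioo.mem_nhds ht'] with x hx using h.branch_apply hx

lemma isCompact_image : IsCompact (p '' Set.Icc α β) := isCompact_Icc.image h.continuous_p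

lemma measurableSet_image : MeasurableSet (p '' Set.Icc α β) := h.isCompact_image.measurableSet

lemma measurable_pushKernel {ρ : ℝ → ℝ} (hρ : Continuous ρ) :
    Measurable (fun q : ℝ × ℝ => pushKernel p p1 ρ s α₀ α β β₀ q.1 q.2) := by
  classical
  -- Off the image of `[α, β]` nothing is known about the regularity of `branch`, so it is replaced
  -- there by zero.
  set τ : ℝ → ℝ := (p '' Set.Icc α β).indicator (branch p α₀ β₀) with hτ
  have hτm : Measurable τ := by
    rw [hτ, ← Set.piecewise_eq_indicator]
    exact ContinuousOn.measurable_piecewise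
      (fun r hr => (h.hasDerivAt_branch hr).continuousAt.continuousWithinAt)
      continuousOn_const h.measurableSet_image
  have heq : (fun q : ℝ × ℝ => pushKernel p p1 ρ s α₀ α β β₀ q.1 q.2) =
      (Prod.snd ⁻¹' (p '' Set.Icc α β)).indicator (fun q : ℝ × ℝ => e (q.1 * τ q.2) *
        ((ρ (τ q.2) / (s * p1 (τ q.2)) : ℝ) : ℂ)) := by
    ext ⟨v, r⟩
    by_cases hr : r ∈ p '' Set.Icc α β
    · have hr2 : ((v, r) : ℝ × ℝ) ∈ (Prod.snd ⁻¹' (p '' Set.Icc α β) : Set (ℝ × ℝ)) := hr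
      rw [Set.indicator_of_mem hr2, pushKernel, Set.indicator_of_mem hr]
      simp only [hτ, Set.indicator_of_mem hr]
    · have hr2 : ((v, r) : ℝ × ℝ) ∉ (Prod.snd ⁻¹' (p '' Set.Icc α β) : Set (ℝ × ℝ)) := hr
      rw [Set.indicator_of_notMem hr2, pushKernel, Set.indicator_of_notMem hr]
  rw [heq]
  refine Measurable.indicator ?_ (measurable_snd h.measurableSet_image)
  have h2 : Measurable fun q : ℝ × ℝ => τ q.2 := hτm.comp measurable_snd
  exact (continuous_e.measurable.comp (measurable_fst.mul h2)).mul
    (Complex.measurable_ofReal.comp ((hρ.measurable.comp h2).div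
      ((h.continuous_p1.measurable.comp h2).const_mul s)))

lemma norm_pushKernel_le {ρ : ℝ → ℝ} {B : ℝ} (hB : ∀ t ∈ Set.Icc α β, |ρ t| ≤ B) (v r : ℝ) :
    ‖pushKernel p p1 ρ s α₀ α β β₀ v r‖ ≤ B / c := by
  have hB0 : 0 ≤ B := (abs_nonneg _).trans (hB α ⟨le_rfl, h.hαβ⟩)
  by_cases hr : r ∈ p '' Set.Icc α β
  · rw [pushKernel, Set.indicator_of_mem hr, norm_mul, norm_e, one_mul, Complex.norm_real,
      Real.norm_eq_abs, abs_div]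
    have hm := (h.branch_mem hr).1
    have h1 := h.lower _ (h.Icc_subset hm)
    exact div_le_div₀ hB0 (hB _ hm) h.c_pos (h1.trans (le_abs_self _))
  · rw [pushKernel, Set.indicator_of_notMem hr, norm_zero]
    exact div_nonneg hB0 h.c_pos.le

/-- Change of variables `r = p t`. -/
lemma integral_eq_pushKernel {ρ : ℝ → ℝ} (hρ : ∀ t ∉ Set.Icc α β, ρ t = 0) (v : ℝ) (G : ℝ → ℂ) :
    ∫ t, (ρ t : ℂ) * e (v * t) * G (p t) = ∫ r, pushKernel p p1 ρ s α₀ α β β₀ v r * G r := by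
  have e1 : ∫ t, (ρ t : ℂ) * e (v * t) * G (p t) =
      ∫ t in Set.Icc α β, (ρ t : ℂ) * e (v * t) * G (p t) := by
    rw [setIntegral_eq_integral_of_forall_compl_eq_zero]
    intro t ht; simp [hρ t ht]
  have e2 : ∫ r, pushKernel p p1 ρ s α₀ α β β₀ v r * G r =
      ∫ r in p '' Set.Icc α β, pushKernel p p1 ρ s α₀ α β β₀ v r * G r := by
    rw [setIntegral_eq_integral_of_forall_compl_eq_zero]
    intro r hr; simp [pushKernel, Set.indicator_of_notMem hr]
  rw [e1, e2, integral_image_eq_integral_abs_deriv_smul measurableSet_Icc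
    (fun t _ => (h.deriv0 t).hasDerivAt.hasDerivWithinAt) (h.injOn.mono h.Icc_subset)]
  refine setIntegral_congr_fun measurableSet_Icc fun t ht => ?_
  have ht' := h.Icc_subset ht
  have h0 : s * p1 t ≠ 0 := mul_ne_zero h.s_ne (h.p1_ne ht')
  simp only [pushKernel, Set.indicator_of_mem (Set.mem_image_of_mem p ht), h.branch_apply ht',
    h.abs_p1 ht', Complex.real_smul]
  have h1 : (ρ t : ℂ) = ((s * p1 t : ℝ) : ℂ) * ((ρ t / (s * p1 t) : ℝ) : ℂ) := by
    rw [← Complex.ofReal_mul]; congr 1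
    rw [mul_div_assoc', mul_div_cancel_left₀ _ h0]
  rw [h1]; ring

/-- `p` is monotone in the direction `s` and the image of `[α, β]` is an interval. Hence the domain
of a correlation integral is a single interval, as van der Corput's test requires. -/
lemma ordConnected_overlap (X : ℝ) :
    {t ∈ Set.Icc α β | p t + X ∈ p '' Set.Icc α β}.OrdConnected := by
  refine ⟨fun x hx y hy z hz => ?_⟩
  have hz' : z ∈ Set.Icc α β := ⟨hx.1.1.trans hz.1, hz.2.trans hy.1.2⟩
  refine ⟨hz', ?_⟩
  have hJ : (p '' Set.Icc α β).OrdConnected :=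
    (isPreconnected_Icc.image _ h.continuous_p.continuousOn).ordConnected
  obtain ⟨w1, hw1, e1⟩ := exists_mvt Set.ordConnected_Ioo (fun t _ => (h.deriv0 t).hasDerivAt)
    (h.Icc_subset hx.1) (h.Icc_subset hz')
  obtain ⟨w2, hw2, e2⟩ := exists_mvt Set.ordConnected_Ioo (fun t _ => (h.deriv0 t).hasDerivAt)
    (h.Icc_subset hz') (h.Icc_subset hy.1)
  have q1 : 0 ≤ s * (p z - p x) := by
    rw [e1, ← mul_assoc]
    exact mul_nonneg (h.c_pos.le.trans (h.lower _ hw1)) (by linarith [hz.1])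
  have q2 : 0 ≤ s * (p y - p z) := by
    rw [e2, ← mul_assoc]
    exact mul_nonneg (h.c_pos.le.trans (h.lower _ hw2)) (by linarith [hz.2])
  rcases (abs_eq zero_le_one).1 h.abs_s with hs | hs
  · refine hJ.out hx.2 hy.2 ⟨?_, ?_⟩ <;> rw [hs] at q1 q2 <;> linarith
  · refine hJ.out hy.2 hx.2 ⟨?_, ?_⟩ <;> rw [hs] at q1 q2 <;> linarith

/-- The derivative of `p''/(p')²` is `-(2p''² - p'''p')/(p')³`, of size at least `c/C³`. A second
use of the mean value theorem trades `|t' - t|` for `|p t' - p t| / C`. -/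
lemma curvature_lower {t t' : ℝ} (ht : t ∈ Set.Icc α β) (ht' : t' ∈ Set.Icc α β) :
    c / C ^ 3 * (|p t' - p t| / C) ≤ |p2 t' / p1 t' ^ 2 - p2 t / p1 t ^ 2| := by
  have hC := h.C_pos
  obtain ⟨w, hw, e1⟩ := exists_mvt Set.ordConnected_Icc (fun t _ => (h.deriv0 t).hasDerivAt) ht ht'
  have hd : ∀ x ∈ Set.Icc α β, HasDerivAt (fun y => p2 y / p1 y ^ 2)
      (-(2 * p2 x ^ 2 - p3 x * p1 x) / p1 x ^ 3) x := by
    intro x hx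
    have hx0 := h.p1_ne (h.Icc_subset hx)
    refine HasDerivAt.congr_deriv
      ((h.deriv2 x).div ((h.deriv1 x).pow 2) (pow_ne_zero 2 hx0)) ?_
    field_simp
    simp
    ring
  obtain ⟨w', hw', e2⟩ := exists_mvt Set.ordConnected_Icc hd ht ht'
  rw [e1, e2, abs_mul, abs_mul, abs_div, abs_neg, abs_pow]
  have hw0 := abs_pos.2 (h.p1_ne (h.Icc_subset hw'))
  have h1 : c / C ^ 3 ≤ |2 * p2 w' ^ 2 - p3 w' * p1 w'| / |p1 w'| ^ 3 := by
    have := h.curv w' hw'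
    have := h.upper1 w' hw'
    have := h.c_pos
    gcongr
  have h2 : |p1 w| * |t' - t| / C ≤ |t' - t| := by
    rw [div_le_iff₀ hC, mul_comm]
    exact mul_le_mul_of_nonneg_left (h.upper1 w hw) (abs_nonneg _)
  exact mul_le_mul h1 h2 (by positivity) (by positivity)

/-- The decay of the correlations of the transported densities. -/
theorem norm_correlation_le {ρ ρ1 : ℝ → ℝ} (hρ0 : ∀ t ∉ Set.Icc α β, ρ t = 0)
    (hρ : ∀ t ∈ Set.Icc α β, HasDerivAt ρ (ρ1 t) t) (hρ1 : Continuous ρ1) {B : ℝ}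
    (hB : ∀ t ∈ Set.Icc α β, |ρ t| ≤ B) (hB1 : ∀ t ∈ Set.Icc α β, |ρ1 t| ≤ B)
    {Λ v v' X : ℝ} (hΛ : 0 < Λ) (hv' : Λ ≤ |v'|) (hX : X ≠ 0) :
    ‖∫ r, pushKernel p p1 ρ s α₀ α β β₀ v r *
      (starRingEnd ℂ) (pushKernel p p1 ρ s α₀ α β β₀ v' (r + X))‖ ≤
    (40 * (B ^ 2 / c) + (B ^ 2 / c + B ^ 2 * C / c ^ 2 + B ^ 2 * C ^ 2 / c ^ 3) * (β - α)) /
      Real.sqrt (Λ * (c ^ 3 / C ^ 5 * |X|)) ∧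
    (C * (β - α) < |X| → ∫ r, pushKernel p p1 ρ s α₀ α β β₀ v r *
      (starRingEnd ℂ) (pushKernel p p1 ρ s α₀ α β β₀ v' (r + X)) = 0) := by
  have hc := h.c_pos
  have hC := h.C_pos
  have hB0 : 0 ≤ B := (abs_nonneg _).trans (hB α ⟨le_rfl, h.hαβ⟩)
  have hβα : 0 ≤ β - α := sub_nonneg.2 h.hαβ
  rw [← h.integral_eq_pushKernel hρ0 v
    (fun r => (starRingEnd ℂ) (pushKernel p p1 ρ s α₀ α β β₀ v' (r + X)))]
  set T : Set ℝ := {t ∈ Set.Icc α β | p t + X ∈ p '' Set.Icc α β} with hT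
  have hTc : IsCompact T := by
    apply isCompact_Icc.inter_right
    exact h.isCompact_image.isClosed.preimage (h.continuous_p.add continuous_const)
  -- After the substitution `r = p t`, the second density is evaluated at `S t`, the point that `p`
  -- carries to `p t + X`.
  set S : ℝ → ℝ := fun t => branch p α₀ β₀ (p t + X) with hS
  have hrestr : ∫ t, (ρ t : ℂ) * e (v * t) *
      (starRingEnd ℂ) (pushKernel p p1 ρ s α₀ α β β₀ v' (p t + X)) =
      ∫ t in T, e (v * t - v' * S t) * ((ρ t * (ρ (S t) / (s * p1 (S t))) : ℝ) : ℂ) := by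
    rw [← setIntegral_eq_integral_of_forall_compl_eq_zero (s := T)]
    · refine setIntegral_congr_fun hTc.measurableSet fun t ht => ?_
      simp only [pushKernel, Set.indicator_of_mem ht.2, map_mul, conj_e, Complex.conj_ofReal]
      rw [sub_eq_add_neg, e_add]
      push_cast
      ring
    · intro t ht
      by_cases ht1 : t ∈ Set.Icc α β
      · have : p t + X ∉ p '' Set.Icc α β := fun h2 => ht ⟨ht1, h2⟩
        simp [pushKernel, Set.indicator_of_notMem this]
      · simp [hρ0 t ht1]
  rw [hrestr]
  have hSm : ∀ t ∈ T, S t ∈ Set.Icc α β ∧ p (S t) = p t + X := fun t ht => h.branch_mem ht.2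
  have hXb : ∀ t ∈ T, |X| ≤ C * (β - α) := by
    intro t ht
    obtain ⟨w, hw, e1⟩ := exists_mvt Set.ordConnected_Icc (fun t _ => (h.deriv0 t).hasDerivAt)
      ht.1 (hSm t ht).1
    have : X = p1 w * (S t - t) := by rw [← e1, (hSm t ht).2]; ring
    rw [this, abs_mul]
    refine mul_le_mul (h.upper1 w hw) ?_ (abs_nonneg _) hC.le
    have := (hSm t ht).1
    have := ht.1
    rw [abs_le]
    constructor <;> linarith [(hSm t ht).1.1, (hSm t ht).1.2, ht.1.1, ht.1.2]
  rcases Set.eq_empty_or_nonempty T with hTe | hTne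
  · rw [hTe]
    simp only [Measure.restrict_empty, integral_zero_measure, norm_zero, implies_true, and_true]
    positivity
  refine ⟨?_, fun hbig => ?_⟩
  swap
  · obtain ⟨t, ht⟩ := hTne
    exact absurd (hXb t ht) (not_le.2 hbig)
  -- A nonempty compact interval-like set is the closed interval between its extreme points.
  have hTI : T = Set.Icc (sInf T) (sSup T) :=
    eq_Icc_of_connected_compact ⟨hTne, (h.ordConnected_overlap X).isPreconnected⟩ hTc
  have ha'T : sInf T ∈ T := hTc.sInf_mem hTne
  have hb'T : sSup T ∈ T := hTc.sSup_mem hTne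
  set α' := sInf T
  set β' := sSup T
  have hα'β' : α' ≤ β' := by
    have := ha'T
    rw [hTI] at this
    exact this.2
  have hlen : β' - α' ≤ β - α := by linarith [ha'T.1.1, hb'T.1.2]
  set S1 : ℝ → ℝ := fun t => p1 t / p1 (S t) with hS1
  set S2 : ℝ → ℝ := fun t => (p2 t * p1 (S t) - p1 t * (p2 (S t) * S1 t)) / p1 (S t) ^ 2 with hS2
  set w : ℝ → ℝ := fun t => s * p1 (S t) with hw
  set a : ℝ → ℝ := fun t => ρ t * (ρ (S t) / w t) with ha
  set a1 : ℝ → ℝ := fun t => ρ1 t * (ρ (S t) / w t) +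
    ρ t * ((ρ1 (S t) * S1 t * w t - ρ (S t) * (s * (p2 (S t) * S1 t))) / w t ^ 2) with ha1
  have hp1S : ∀ t ∈ T, p1 (S t) ≠ 0 := fun t ht => h.p1_ne (h.Icc_subset (hSm t ht).1)
  have hwc : ∀ t ∈ T, c ≤ w t := fun t ht => h.lower _ (h.Icc_subset (hSm t ht).1)
  have hw0 : ∀ t ∈ T, w t ≠ 0 := fun t ht => (hc.trans_le (hwc t ht)).ne'
  have dS : ∀ t ∈ T, HasDerivAt S (S1 t) t := by
    intro t ht
    have := (h.hasDerivAt_branch ht.2).comp t ((h.deriv0 t).hasDerivAt.add_const X)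
    exact this.congr_deriv (by simp only [hS1, hS]; field_simp)
  have dp1S : ∀ t ∈ T, HasDerivAt (fun t => p1 (S t)) (p2 (S t) * S1 t) t := fun t ht =>
    (h.deriv1 _).comp t (dS t ht)
  have dS1 : ∀ t ∈ T, HasDerivAt S1 (S2 t) t := fun t ht =>
    (h.deriv1 t).div (dp1S t ht) (hp1S t ht)
  have dw : ∀ t ∈ T, HasDerivAt w (s * (p2 (S t) * S1 t)) t := fun t ht =>
    (dp1S t ht).const_mul s
  have dρS : ∀ t ∈ T, HasDerivAt (fun t => ρ (S t)) (ρ1 (S t) * S1 t) t := fun t ht =>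
    (hρ _ (hSm t ht).1).comp t (dS t ht)
  have da : ∀ t ∈ T, HasDerivAt a (a1 t) t := fun t ht =>
    (hρ t ht.1).mul ((dρS t ht).div (dw t ht) (hw0 t ht))
  have con : ∀ {f f' : ℝ → ℝ}, (∀ t ∈ T, HasDerivAt f (f' t) t) → ContinuousOn f T :=
    fun hf t ht => (hf t ht).continuousAt.continuousWithinAt
  have cS := con dS
  have cS1 := con dS1
  have cp1S := con dp1S
  have cw := con dw
  have ca := con da
  have cρ : ContinuousOn ρ T := con fun t ht => hρ t ht.1
  have cρS := con dρS
  have cp1 : ContinuousOn p1 T := h.continuous_p1.continuousOn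
  have cp2 : ContinuousOn p2 T := h.continuous_p2.continuousOn
  have cp2S : ContinuousOn (fun t => p2 (S t)) T := h.continuous_p2.comp_continuousOn cS
  have cρ1 : ContinuousOn ρ1 T := hρ1.continuousOn
  have cρ1S : ContinuousOn (fun t => ρ1 (S t)) T := hρ1.comp_continuousOn cS
  have cS2 : ContinuousOn S2 T :=
    ContinuousOn.div ((cp2.mul cp1S).sub (cp1.mul (cp2S.mul cS1))) (cp1S.pow 2)
      fun t ht => pow_ne_zero 2 (hp1S t ht)
  have ca1 : ContinuousOn a1 T :=
    (cρ1.mul (cρS.div cw hw0)).add (cρ.mul (ContinuousOn.div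
      (((cρ1S.mul cS1).mul cw).sub (cρS.mul (continuousOn_const.mul (cp2S.mul cS1)))) (cw.pow 2)
      fun t ht => pow_ne_zero 2 (hw0 t ht)))
  -- The linear term `v t` drops out of the second derivative, and `S'' = p'(t)²/p'(S) ·
  -- (p''(t)/p'(t)² - p''(S)/p'(S)²)`. The bracket is bounded below by `curvature_lower`, since `p(S
  -- t) - p(t) = X`.
  have hbig : ∀ t ∈ T, Λ * (c ^ 3 / C ^ 5 * |X|) ≤ |-(v' * S2 t)| := by
    intro t ht
    rw [abs_neg, abs_mul]
    refine mul_le_mul hv' ?_ (by positivity) (abs_nonneg _)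
    have h1 := h.curvature_lower (hSm t ht).1 ht.1
    have h2 : S2 t = p1 t ^ 2 / p1 (S t) * (p2 t / p1 t ^ 2 - p2 (S t) / p1 (S t) ^ 2) := by
      have := hp1S t ht
      have := h.p1_ne (h.Icc_subset ht.1)
      simp only [hS2, hS1]; field_simp
    rw [(hSm t ht).2, show p t - (p t + X) = -X by ring, abs_neg] at h1
    rw [h2, abs_mul, abs_div, abs_pow]
    have h3 := h.lower_abs (h.Icc_subset ht.1)
    have h4 := h.upper1 _ (hSm t ht).1
    have h5 := abs_pos.2 (hp1S t ht)
    calc c ^ 3 / C ^ 5 * |X| = c ^ 2 / C * (c / C ^ 3 * (|X| / C)) := by field_simp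
      _ ≤ _ := by gcongr
  have hAb : ∀ t ∈ T, |a t| ≤ B ^ 2 / c := by
    intro t ht
    simp only [ha]
    rw [abs_mul, abs_div, abs_of_pos (hc.trans_le (hwc t ht))]
    have h1 := hB t ht.1
    have h2 := hB _ (hSm t ht).1
    have h3 := hwc t ht
    have hwp := hc.trans_le h3
    calc _ ≤ B * (B / c) := by gcongr
      _ = _ := by ring
  have hAb1 : ∀ t ∈ T, |a1 t| ≤ B ^ 2 / c + B ^ 2 * C / c ^ 2 + B ^ 2 * C ^ 2 / c ^ 3 := by
    intro t ht
    have g1 := hB t ht.1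
    have g2 := hB _ (hSm t ht).1
    have g3 := hwc t ht
    have g4 := hB1 t ht.1
    have g5 := hB1 _ (hSm t ht).1
    have g6 := h.upper2 _ (hSm t ht).1
    have hwp := hc.trans_le g3
    have g7 : |S1 t| ≤ C / c := by
      simp only [hS1]
      rw [abs_div]
      have := h.upper1 t ht.1
      have := h.lower_abs (h.Icc_subset (hSm t ht).1)
      gcongr
    have g8 : a1 t = ρ1 t * (ρ (S t) / w t) + (ρ t * (ρ1 (S t) * S1 t / w t) -
        ρ t * (ρ (S t) * (s * (p2 (S t) * S1 t)) / w t ^ 2)) := by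
      have := hw0 t ht
      simp only [ha1]; field_simp
    rw [g8, add_assoc]
    refine (abs_add_le _ _).trans (add_le_add ?_ ((abs_sub _ _).trans (add_le_add ?_ ?_)))
    · rw [abs_mul, abs_div, abs_of_pos hwp]
      calc _ ≤ B * (B / c) := by gcongr
        _ = _ := by ring
    · rw [abs_mul, abs_div, abs_mul, abs_of_pos hwp]
      calc _ ≤ B * (B * (C / c) / c) := by gcongr
        _ = _ := by field_simp
    · rw [abs_mul, abs_div, abs_mul, abs_mul, abs_mul, abs_pow, abs_of_pos hwp, h.abs_s, one_mul]
      calc _ ≤ B * (B * (C * (C / c)) / c ^ 2) := by gcongr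
        _ = _ := by field_simp
  have dφ : ∀ t ∈ T, HasDerivAt (fun t => v * t - v' * S t) (v - v' * S1 t) t := fun t ht => by
    exact HasDerivAt.congr_deriv (((hasDerivAt_id t).const_mul v).sub ((dS t ht).const_mul v'))
      (by simp)
  have dφ1 : ∀ t ∈ T, HasDerivAt (fun t => v - v' * S1 t) (-(v' * S2 t)) t := fun t ht =>
    ((dS1 t ht).const_mul v').const_sub v
  have cφ := con dφ
  have cφ1 := con dφ1
  have cφ2 : ContinuousOn (fun t => -(v' * S2 t)) T := (continuousOn_const.mul cS2).neg
  have hsub : ∀ t ∈ Set.Ioo α' β', t ∈ T := fun t ht => by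
    rw [hTI]; exact Set.Ioo_subset_Icc_self ht
  have vdc := vanDerCorput hα'β' (lam := Λ * (c ^ 3 / C ^ 5 * |X|))
    (by have := abs_pos.2 hX; positivity)
    (hTI ▸ cφ) (hTI ▸ cφ1) (hTI ▸ cφ2) (hTI ▸ ca) (hTI ▸ ca1)
    (fun t ht => dφ t (hsub t ht)) (fun t ht => dφ1 t (hsub t ht)) (fun t ht => da t (hsub t ht))
    (hTI ▸ hbig) (hTI ▸ hAb) (hTI ▸ hAb1)
  rw [hTI, integral_Icc_eq_integral_Ioc, ← intervalIntegral.integral_of_le hα'β']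
  refine vdc.trans ?_
  gcongr

end IsCurved
-- The single-scale estimate for a curved phase
lemma lintegral_sq_eq_ofReal {X : Type*} [MeasurableSpace X] {μ : Measure X} [IsFiniteMeasure μ]
    {f : X → ℂ} (hf : Measurable f) {M : ℝ} (hM : ∀ x, ‖f x‖ ≤ M) :
    ∫⁻ x, ‖f x‖ₑ ^ 2 ∂μ = ENNReal.ofReal (∫ x, ‖f x‖ ^ 2 ∂μ) := by
  rw [ofReal_integral_eq_lintegral_ofReal]
  · congr 1; ext x
    rw [ENNReal.ofReal_pow (norm_nonneg _), ofReal_norm]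
  · exact Integrable.of_bound (hf.norm.pow_const 2).aestronglyMeasurable (M ^ 2)
      (Filter.Eventually.of_forall fun x => by
        rw [Real.norm_of_nonneg (by positivity)]
        exact pow_le_pow_left₀ (norm_nonneg _) (hM x) 2)
  · exact Filter.Eventually.of_forall fun x => by positivity

theorem lintegral_sq_le_of_ttstar {X Y : Type*} [MeasurableSpace X] [MeasurableSpace Y]
    {μ : Measure X} {ν : Measure Y} [IsFiniteMeasure μ] [IsFiniteMeasure ν] {k : X → Y → ℂ}
    (hk : Measurable (Function.uncurry k)) {M : ℝ} (hM : ∀ x z, ‖k x z‖ ≤ M) {B : ℝ} (hB0 : 0 < B)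
    (hB : ∀ x, ∫ y, ‖∫ z, k x z * (starRingEnd ℂ) (k y z) ∂ν‖ ∂μ ≤ B)
    {g : Y → ℂ} (hg : Measurable g) {Mg : ℝ} (hMg : ∀ z, ‖g z‖ ≤ Mg) :
    ∫⁻ x, ‖∫ z, k x z * g z ∂ν‖ₑ ^ 2 ∂μ ≤ ENNReal.ofReal B * ∫⁻ z, ‖g z‖ₑ ^ 2 ∂ν := by
  have hFm : Measurable fun x => ∫ z, k x z * g z ∂ν :=
    ((hk.mul (hg.comp measurable_snd)).stronglyMeasurable.integral_prod_right
      (f := fun x z => k x z * g z) (ν := ν)).measurable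
  have hFb : ∀ x, ‖∫ z, k x z * g z ∂ν‖ ≤ M * Mg * ν.real Set.univ := fun x =>
    norm_integral_le_of_norm_le_const (Filter.Eventually.of_forall fun z => by
      rw [norm_mul]
      exact mul_le_mul (hM x z) (hMg z) (norm_nonneg _) ((norm_nonneg _).trans (hM x z)))
  rw [lintegral_sq_eq_ofReal hFm hFb, lintegral_sq_eq_ofReal hg hMg, ← ENNReal.ofReal_mul hB0.le]
  exact ENNReal.ofReal_le_ofReal (integral_normSq_le_of_ttstar hk hM hB0 hB hg hMg)

lemma integrableOn_inv_sqrt_abs (R : ℝ) :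
    IntegrableOn (fun x : ℝ => 1 / Real.sqrt |x|) (Set.Icc (-R) R) := by
  rcases lt_or_ge R 0 with hR | hR
  · rw [Set.Icc_eq_empty (by linarith)]; exact integrableOn_empty
  have h1 : IntervalIntegrable (fun x : ℝ => 1 / Real.sqrt |x|) volume 0 R := by
    have := intervalIntegral.intervalIntegrable_rpow' (a := 0) (b := R) (r := -(1 / 2 : ℝ))
      (by norm_num)
    refine this.congr ?_
    intro x hx
    rw [Set.uIoc_of_le hR] at hx
    simp only
    rw [abs_of_pos hx.1, Real.sqrt_eq_rpow, Real.rpow_neg hx.1.le, one_div, one_div]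
  have h2 : IntervalIntegrable (fun x : ℝ => 1 / Real.sqrt |x|) volume (-R) 0 := by
    have := (IntervalIntegrable.iff_comp_neg).1 h1
    simpa using this.symm
  have h3 := h2.trans h1
  rwa [intervalIntegrable_iff_integrableOn_Icc_of_le (by linarith)] at h3

/-- The constant in the bound for the correlations of the transported densities. -/
noncomputable def corrConst (B c C L : ℝ) : ℝ :=
  (40 * (B ^ 2 / c) + (B ^ 2 / c + B ^ 2 * C / c ^ 2 + B ^ 2 * C ^ 2 / c ^ 3) * L) /
    Real.sqrt (c ^ 3 / C ^ 5)

/-- The constant in the single scale estimate. -/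
noncomputable def scaleConst (B c C L BW : ℝ) : ℝ :=
  BW ^ 2 * (corrConst B c C L + 1) *
    ((∫ x in Set.Icc (-(C * L)) (C * L), 1 / Real.sqrt |x|) + 1)

lemma corrConst_nonneg {B c C L : ℝ} (hc : 0 < c) (hC : 0 < C) (hL : 0 ≤ L) :
    0 ≤ corrConst B c C L := by
  unfold corrConst; positivity

lemma scaleConst_pos {B c C L BW : ℝ} (hc : 0 < c) (hC : 0 < C) (hL : 0 ≤ L) (hBW : 0 < BW) :
    0 < scaleConst B c C L BW := by
  have h1 := corrConst_nonneg (B := B) hc hC hL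
  have h2 : 0 ≤ ∫ x in Set.Icc (-(C * L)) (C * L), 1 / Real.sqrt |x| :=
    integral_nonneg fun x => by positivity
  unfold scaleConst; positivity

/-- The `L²` bound at a single scale, by the `T T*` method. -/
theorem IsCurved.lintegral_sq_le {p p1 p2 p3 : ℝ → ℝ} {s α₀ α β β₀ c C : ℝ}
    (h : IsCurved p p1 p2 p3 s α₀ α β β₀ c C) {ρ ρ1 : ℝ → ℝ} (hρc : Continuous ρ)
    (hρ0 : ∀ t ∉ Set.Icc α β, ρ t = 0)
    (hρ : ∀ t ∈ Set.Icc α β, HasDerivAt ρ (ρ1 t) t) (hρ1 : Continuous ρ1) {B : ℝ}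
    (hB : ∀ t ∈ Set.Icc α β, |ρ t| ≤ B) (hB1 : ∀ t ∈ Set.Icc α β, |ρ1 t| ≤ B)
    {W : ℝ → ℂ} (hW : Measurable W) {BW : ℝ} (hBW0 : 0 < BW) (hBW : ∀ x, ‖W x‖ ≤ BW)
    {v : ℝ → ℝ} (hv : Measurable v) {Λ : ℝ} (hΛ : 0 < Λ) (hWv : ∀ x, W x ≠ 0 → Λ ≤ |v x|)
    {g : ℝ → ℂ} (hg : Measurable g) {Mg : ℝ} (hMg : ∀ z, ‖g z‖ ≤ Mg) :
    ∫⁻ x, ‖W x * ∫ t, (ρ t : ℂ) * e (v x * t) * g (x + p t)‖ₑ ^ 2 ≤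
      ENNReal.ofReal (scaleConst B c C (β - α) BW / Real.sqrt Λ) * ∫⁻ z, ‖g z‖ₑ ^ 2 := by
  have hc := h.c_pos
  have hC := h.C_pos
  have hL : 0 ≤ β - α := sub_nonneg.2 h.hαβ
  have hsΛ := Real.sqrt_pos.2 hΛ
  set κ : ℝ → ℝ → ℂ := pushKernel p p1 ρ s α₀ α β β₀ with hκ
  set k : ℝ → ℝ → ℂ := fun x z => W x * κ (v x) (z - x) with hk
  have hkm : Measurable (Function.uncurry k) :=
    (hW.comp measurable_fst).mul ((h.measurable_pushKernel hρc).comp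
      ((hv.comp measurable_fst).prodMk (measurable_snd.sub measurable_fst)))
  have hB0 : 0 ≤ B := (abs_nonneg _).trans (hB α ⟨le_rfl, h.hαβ⟩)
  have hkb : ∀ x z, ‖k x z‖ ≤ BW * (B / c) := fun x z => by
    rw [hk, norm_mul]
    exact mul_le_mul (hBW x) (h.norm_pushKernel_le hB _ _) (norm_nonneg _) hBW0.le
  obtain ⟨R, hR⟩ := h.isCompact_image.isBounded.subset_closedBall (0 : ℝ)
  have hksupp : ∀ x z, R < |z - x| → k x z = 0 := by
    intro x z hz
    have : z - x ∉ p '' Set.Icc α β := fun hm => by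
      have := hR hm
      rw [Metric.mem_closedBall, dist_zero_right, Real.norm_eq_abs] at this
      exact absurd hz (not_lt.2 this)
    simp [hk, hκ, pushKernel, Set.indicator_of_notMem this]
  set D := corrConst B c C (β - α) with hD
  have hD0 : 0 ≤ D := corrConst_nonneg hc hC hL
  set Q := C * (β - α) with hQ
  -- With division by zero equal to zero, `maj 0 = 0`. The kernel bound is therefore claimed only
  -- for `x ≠ y`, which suffices because the diagonal is null in each row.
  set maj : ℝ → ℝ := (Set.Icc (-Q) Q).indicator fun X => 1 / Real.sqrt |X| with hmaj
  have hmaji : Integrable maj :=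
    (integrable_indicator_iff measurableSet_Icc).2 (integrableOn_inv_sqrt_abs Q)
  set J := ∫ x in Set.Icc (-Q) Q, 1 / Real.sqrt |x| with hJ
  have hJ0 : 0 ≤ J := integral_nonneg fun x => by positivity
  have hmajJ : ∫ X, maj X = J := integral_indicator measurableSet_Icc
  have hmaj0 : ∀ X, 0 ≤ maj X := fun X => Set.indicator_nonneg (fun x _ => by positivity) X
  -- the kernel of `T T*`
  have hK : ∀ x y, x ≠ y →
      ‖∫ z, k x z * (starRingEnd ℂ) (k y z)‖ ≤ BW ^ 2 * (D / Real.sqrt Λ) * maj (x - y) := by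
    intro x y hxy
    have hnn : 0 ≤ BW ^ 2 * (D / Real.sqrt Λ) * maj (x - y) :=
      mul_nonneg (by positivity) (hmaj0 _)
    by_cases hWy : W y = 0
    · simpa [hk, hWy] using hnn
    have hX : x - y ≠ 0 := sub_ne_zero.2 hxy
    have e1 : ∫ z, k x z * (starRingEnd ℂ) (k y z) = (W x * (starRingEnd ℂ) (W y)) *
        ∫ r, κ (v x) r * (starRingEnd ℂ) (κ (v y) (r + (x - y))) := by
      rw [← integral_add_right_eq_self _ x, ← integral_const_mul]
      congr 1; ext r
      simp only [hk, map_mul, add_sub_cancel_right]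
      rw [show r + x - y = r + (x - y) by ring]; ring
    obtain ⟨b1, b2⟩ := h.norm_correlation_le hρ0 hρ hρ1 hB hB1 (v := v x) hΛ (hWv y hWy) hX
    rw [e1, norm_mul, norm_mul, RCLike.norm_conj]
    by_cases hm : x - y ∈ Set.Icc (-Q) Q
    · have b3 : ‖∫ r, κ (v x) r * (starRingEnd ℂ) (κ (v y) (r + (x - y)))‖ ≤
          D / Real.sqrt Λ * maj (x - y) := by
        refine b1.trans_eq ?_
        rw [hmaj, Set.indicator_of_mem hm, hD, corrConst, Real.sqrt_mul hΛ.le,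
          Real.sqrt_mul (by positivity)]
        have := Real.sqrt_pos.2 (abs_pos.2 hX)
        have : 0 < Real.sqrt (c ^ 3 / C ^ 5) := Real.sqrt_pos.2 (by positivity)
        rw [div_div, div_mul_div_comm, mul_one]
        congr 1
        ring
      calc _ ≤ (BW * BW) * (D / Real.sqrt Λ * maj (x - y)) :=
            mul_le_mul (mul_le_mul (hBW x) (hBW y) (norm_nonneg _) hBW0.le) b3 (norm_nonneg _)
              (by positivity)
        _ = _ := by ring
    · have : Q < |x - y| := by
        by_contra hcon
        exact hm (abs_le.1 (not_lt.1 hcon))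
      rw [b2 this, norm_zero, mul_zero]
      exact hnn
  set Btot := scaleConst B c C (β - α) BW / Real.sqrt Λ with hBtot
  -- The summands `1` in `scaleConst` make it strictly positive, as the `T T*` lemma requires of its
  -- bound.
  have hBtot0 : 0 < Btot := div_pos (scaleConst_pos hc hC hL hBW0) hsΛ
  have hBle : BW ^ 2 * (D / Real.sqrt Λ) * J ≤ Btot := by
    rw [hBtot, scaleConst, ← hD, ← hQ, ← hJ]
    calc _ = BW ^ 2 * D * J / Real.sqrt Λ := by ring
      _ ≤ _ := by gcongr <;> linarith
  set A : ℝ → ℂ := fun x => W x * ∫ t, (ρ t : ℂ) * e (v x * t) * g (x + p t) with hA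
  have hAk : ∀ x, A x = ∫ z, k x z * g z := by
    intro x
    rw [hA]
    dsimp only
    rw [h.integral_eq_pushKernel hρ0 (v x) (fun r => g (x + r)),
      ← integral_add_right_eq_self (fun z => k x z * g z) x, ← integral_const_mul]
    congr 1; ext r
    simp only [hk, add_sub_cancel_right]
    rw [add_comm x r]; ring
  -- The `T T*` lemma concerns finite measures. For `x` in a bounded interval the kernel lives on a
  -- bounded set of `z`, so both variables may be truncated; the bound does not depend on `n`.
  have hbox : ∀ n : ℕ, ∫⁻ x in Set.Icc (-(n : ℝ)) n, ‖A x‖ₑ ^ 2 ≤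
      ENNReal.ofReal Btot * ∫⁻ z, ‖g z‖ₑ ^ 2 := by
    intro n
    set box : Set ℝ := Set.Icc (-(n : ℝ) - R) (n + R) with hboxd
    have hout : ∀ x ∈ Set.Icc (-(n : ℝ)) n, ∀ z ∉ box, k x z = 0 := by
      intro x hx z hz
      apply hksupp
      by_contra hcon
      have := abs_le.1 (not_lt.1 hcon)
      exact hz ⟨by linarith [hx.1], by linarith [hx.2]⟩
    have e1 : ∫⁻ x in Set.Icc (-(n : ℝ)) n, ‖A x‖ₑ ^ 2 =
        ∫⁻ x in Set.Icc (-(n : ℝ)) n, ‖∫ z in box, k x z * g z‖ₑ ^ 2 := by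
      refine setLIntegral_congr_fun measurableSet_Icc fun x hx => ?_
      rw [hAk, setIntegral_eq_integral_of_forall_compl_eq_zero]
      intro z hz; rw [hout x hx z hz, zero_mul]
    rw [e1]
    refine (lintegral_sq_le_of_ttstar (μ := volume.restrict (Set.Icc (-(n : ℝ)) n))
      (ν := volume.restrict box) hkm hkb hBtot0 ?_ hg hMg).trans ?_
    · intro x
      refine le_trans ?_ hBle
      have e2 : ∫ y in Set.Icc (-(n : ℝ)) n, ‖∫ z in box, k x z * (starRingEnd ℂ) (k y z)‖ =
          ∫ y in Set.Icc (-(n : ℝ)) n, ‖∫ z, k x z * (starRingEnd ℂ) (k y z)‖ := by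
        refine setIntegral_congr_fun measurableSet_Icc fun y hy => ?_
        rw [setIntegral_eq_integral_of_forall_compl_eq_zero]
        intro z hz; rw [hout y hy z hz, map_zero, mul_zero]
      rw [e2, ← hmajJ, ← integral_const_mul]
      have hmi : Integrable fun y => BW ^ 2 * (D / Real.sqrt Λ) * maj (x - y) :=
        (hmaji.comp_sub_left x).const_mul _
      rw [← integral_sub_left_eq_self (fun X => BW ^ 2 * (D / Real.sqrt Λ) * maj X) volume x]
      calc _ ≤ ∫ y in Set.Icc (-(n : ℝ)) n, BW ^ 2 * (D / Real.sqrt Λ) * maj (x - y) := by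
            refine integral_mono_of_nonneg (Filter.Eventually.of_forall fun y => norm_nonneg _)
              hmi.integrableOn ?_
            refine ae_restrict_of_ae ?_
            filter_upwards [compl_mem_ae_iff.2 (measure_singleton x)] with y hy
            exact hK x y fun hh => hy hh.symm
        _ ≤ _ := setIntegral_le_integral hmi (Filter.Eventually.of_forall fun y =>
            mul_nonneg (by positivity) (hmaj0 _))
    · exact mul_le_mul_right (setLIntegral_le_lintegral _ _) _
  have hmono : Filter.Tendsto (fun n : ℕ => ∫⁻ x in Set.Icc (-(n : ℝ)) n, ‖A x‖ₑ ^ 2) Filter.atTop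
      (nhds (∫⁻ x, ‖A x‖ₑ ^ 2)) := by
    have hAm : Measurable A := by
      have : A = fun x => ∫ z, k x z * g z := funext hAk
      rw [this]
      exact ((hkm.mul (hg.comp measurable_snd)).stronglyMeasurable.integral_prod_right
        (f := fun x z => k x z * g z) (ν := volume)).measurable
    exact (aecover_Icc (Filter.tendsto_neg_atTop_atBot.comp tendsto_natCast_atTop_atTop)
      tendsto_natCast_atTop_atTop).lintegral_tendsto_of_countably_generated
      (hAm.enorm.pow_const 2).aemeasurable
  exact le_of_tendsto' hmono hbox

/-! ### Perturbed monomials are curved -/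

/-- The `n`-th derivative of the monomial sum `∑ b_i t^i`. -/
noncomputable def polyDeriv (F : Finset ℕ) (b : ℕ → ℝ) (n : ℕ) (t : ℝ) : ℝ :=
  ∑ i ∈ F, b i * (i.descFactorial n * t ^ (i - n))

/-- Truncated subtraction is harmless: `descFactorial i (n+1) = (i - n) * descFactorial i n`
vanishes as soon as `i ≤ n`. -/
lemma hasStrictDerivAt_polyDeriv (F : Finset ℕ) (b : ℕ → ℝ) (n : ℕ) (t : ℝ) :
    HasStrictDerivAt (polyDeriv F b n) (polyDeriv F b (n + 1) t) t := by
  unfold polyDeriv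
  refine HasStrictDerivAt.fun_sum fun i _ => ?_
  have h := (((hasStrictDerivAt_pow (i - n) t).const_mul (i.descFactorial n : ℝ)).const_mul (b i))
  refine h.congr_deriv ?_
  rw [Nat.descFactorial_succ, Nat.sub_sub]
  push_cast
  ring

lemma abs_descFactorial_mul_pow_le {N i n : ℕ} (hN : 1 ≤ N) (hi : i ≤ N) (hn : n ≤ 3) {t : ℝ}
    (ht : |t| ≤ 10) : |(i.descFactorial n : ℝ) * t ^ (i - n)| ≤ N ^ 3 * 10 ^ N := by
  have hN' : (1 : ℝ) ≤ N := by exact_mod_cast hN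
  rw [abs_mul, abs_pow, Nat.abs_cast]
  refine mul_le_mul ?_ ?_ (by positivity) (by positivity)
  · calc (i.descFactorial n : ℝ) ≤ (i : ℝ) ^ n := by exact_mod_cast Nat.descFactorial_le_pow i n
      _ ≤ (N : ℝ) ^ n := by gcongr
      _ ≤ (N : ℝ) ^ 3 := pow_le_pow_right₀ hN' hn
  · calc |t| ^ (i - n) ≤ 10 ^ (i - n) := by gcongr
      _ ≤ 10 ^ N := pow_le_pow_right₀ (by norm_num) (by omega)

lemma abs_polyDeriv_le {N : ℕ} (hN : 1 ≤ N) {F : Finset ℕ} (hF : F ⊆ Finset.Icc 2 N) {b : ℕ → ℝ}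
    {δ : ℝ} (hδ : 0 ≤ δ) (hb : ∀ i ∈ F, |b i| ≤ δ) {n : ℕ} (hn : n ≤ 3) {t : ℝ} (ht : |t| ≤ 10) :
    |polyDeriv F b n t| ≤ N * (δ * (N ^ 3 * 10 ^ N)) := by
  have hcard : F.card ≤ N := (Finset.card_le_card hF).trans (by simp)
  unfold polyDeriv
  calc _ ≤ ∑ i ∈ F, |b i * (i.descFactorial n * t ^ (i - n))| := Finset.abs_sum_le_sum_abs _ _
    _ ≤ ∑ i ∈ F, δ * (N ^ 3 * 10 ^ N) := Finset.sum_le_sum fun i hi => by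
        rw [abs_mul]
        exact mul_le_mul (hb i hi) (abs_descFactorial_mul_pow_le hN
          (Finset.mem_Icc.1 (hF hi)).2 hn ht) (abs_nonneg _) hδ
    _ = F.card * (δ * (N ^ 3 * 10 ^ N)) := by rw [Finset.sum_const, nsmul_eq_mul]
    _ ≤ _ := by gcongr

/-- For `t^l` the expression `2p''² - p'''p'` equals `l³(l-1) t^{2l-4}`: the product `p'''p'` does
not cancel the square. The coefficient is at least 1 precisely because `l ≥ 2`. -/
lemma monomial_curvature {l : ℕ} (hl : 2 ≤ l) (t : ℝ) :
    (t ^ (l - 2)) ^ 2 ≤ 2 * ((l.descFactorial 2 : ℝ) * t ^ (l - 2)) ^ 2 -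
      ((l.descFactorial 3 : ℝ) * t ^ (l - 3)) * ((l.descFactorial 1 : ℝ) * t ^ (l - 1)) := by
  obtain ⟨k, rfl⟩ := Nat.exists_eq_add_of_le' hl
  have e : 2 * (((k + 2).descFactorial 2 : ℝ) * t ^ (k + 2 - 2)) ^ 2 -
      (((k + 2).descFactorial 3 : ℝ) * t ^ (k + 2 - 3)) *
        (((k + 2).descFactorial 1 : ℝ) * t ^ (k + 2 - 1)) =
      ((k : ℝ) + 2) ^ 3 * (k + 1) * (t ^ k) ^ 2 := by
    rcases k with _ | k
    · simp [Nat.descFactorial]; norm_num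
    · rw [show k + 1 + 2 - 2 = k + 1 by omega, show k + 1 + 2 - 3 = k by omega,
        show k + 1 + 2 - 1 = k + 2 by omega]
      simp only [Nat.descFactorial]
      rw [show k + 1 + 2 - 2 = k + 1 by omega, show k + 1 + 2 - 1 = k + 2 by omega,
        show k + 1 + 2 - 0 = k + 3 by omega]
      push_cast
      ring
  rw [e, show k + 2 - 2 = k by omega]
  have hk : (0 : ℝ) ≤ k := k.cast_nonneg
  refine le_mul_of_one_le_left (by positivity) ?_
  have h1 : (1 : ℝ) ≤ (k + 2) ^ 3 := one_le_pow₀ (by linarith)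
  nlinarith

/-- Perturbations of a monomial `t ^ l`, `l ≥ 2`, are curved phases near `[1/9, 9]` and its
reflection, with uniform constants. -/
theorem exists_isCurved (N : ℕ) (hN : 2 ≤ N) : ∃ K₀ > (0 : ℝ), ∃ c > (0 : ℝ), ∃ C > (0 : ℝ),
    ∀ l : ℕ, 2 ≤ l → l ≤ N → ∀ b : ℕ → ℝ, b l = 1 →
      (∀ i ∈ Finset.Icc 2 N, i ≠ l → |b i| ≤ 1 / K₀) → ∀ σ : ℤˣ, ∃ s α₀ α β β₀ : ℝ,
        IsCurved (polyDeriv (Finset.Icc 2 N) b 0) (polyDeriv (Finset.Icc 2 N) b 1)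
          (polyDeriv (Finset.Icc 2 N) b 2) (polyDeriv (Finset.Icc 2 N) b 3) s α₀ α β β₀ c C ∧
        β - α = 9 - 1 / 9 ∧ ∀ t, t ∈ Set.Icc α β ↔ ((σ : ℤ) : ℝ) * t ∈ Set.Icc (1 / 9 : ℝ) 9 := by
  have hN1 : (1 : ℝ) ≤ N := by exact_mod_cast (by omega : 1 ≤ N)
  -- `η` bounds from below every power `y^k`, `k ≤ N`, `y ≥ 1/10`; `M` bounds from above the first
  -- three derivatives of `t^l` on `|t| ≤ 10`.
  set η : ℝ := (1 / 10) ^ N with hη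
  set M : ℝ := N ^ 3 * 10 ^ N with hM
  have hη0 : 0 < η := by positivity
  have hη1 : η ≤ 1 := pow_le_one₀ (by norm_num) (by norm_num)
  have hM1 : 1 ≤ M := one_le_mul_of_one_le_of_one_le (one_le_pow₀ hN1) (one_le_pow₀ (by norm_num))
  -- Chosen so that the lower-order coefficients move each derivative by at most `δ = η²/(6(2M+1))`.
  -- The resulting change of `2p''² - p'''p'` is at most `2δ(2M+1) + δ(M+1) + Mδ = 3(2M+1)δ = η²/2`,
  -- half of its main term.
  set K₀ : ℝ := N * M * (6 * (2 * M + 1)) / η ^ 2 with hK₀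
  have hK₀0 : 0 < K₀ := by positivity
  refine ⟨K₀, hK₀0, η ^ 2 / 2, by positivity, M + 1, by positivity, ?_⟩
  intro l hl hlN b hbl hb
  set δ : ℝ := η ^ 2 / (6 * (2 * M + 1)) with hδ
  have hδ0 : 0 < δ := by positivity
  have hδK : N * (1 / K₀ * M) = δ := by rw [hK₀, hδ]; field_simp
  have hδM : 3 * (2 * M + 1) * δ = η ^ 2 / 2 := by rw [hδ]; field_simp; norm_num
  have hη2 : η ^ 2 ≤ η := by nlinarith
  have hδη : δ ≤ η / 2 := by nlinarith
  have hδ1 : δ ≤ 1 := by linarith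
  set p : ℕ → ℝ → ℝ := polyDeriv (Finset.Icc 2 N) b with hp
  set q : ℕ → ℝ → ℝ := fun n t => (l.descFactorial n : ℝ) * t ^ (l - n) with hq
  have hpq : ∀ n ≤ 3, ∀ t : ℝ, |t| ≤ 10 → |p n t - q n t| ≤ δ := by
    intro n hn t ht
    have e1 : p n t - q n t = polyDeriv ((Finset.Icc 2 N).erase l) b n t := by
      have hmem : l ∈ Finset.Icc 2 N := Finset.mem_Icc.2 ⟨hl, hlN⟩
      simp only [hp, polyDeriv, hq]
      rw [← Finset.add_sum_erase _ _ hmem, hbl, one_mul]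
      ring
    rw [e1, ← hδK]
    refine abs_polyDeriv_le (by omega) (Finset.erase_subset _ _) (by positivity) ?_ hn ht
    intro i hi
    exact hb i (Finset.mem_of_mem_erase hi) (Finset.ne_of_mem_erase hi)
  have hqM : ∀ n ≤ 3, ∀ t : ℝ, |t| ≤ 10 → |q n t| ≤ M := fun n hn t ht =>
    abs_descFactorial_mul_pow_le (by omega) hlN hn ht
  have hpow : ∀ y : ℝ, 1 / 10 ≤ y → ∀ k ≤ N, η ≤ y ^ k := by
    intro y hy k hk
    calc η ≤ (1 / 10) ^ k := pow_le_pow_of_le_one (by norm_num) (by norm_num) hk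
      _ ≤ y ^ k := by gcongr
  -- Both half-lines are treated at once: `ε` is the sign of `t`, and `ε^(l-1)` is then the sign of
  -- `p'`.
  have main : ∀ ε : ℝ, (ε = 1 ∨ ε = -1) → ∀ t : ℝ, 1 / 10 ≤ ε * t → ε * t ≤ 10 →
      η ^ 2 / 2 ≤ ε ^ (l - 1) * p 1 t ∧ |p 1 t| ≤ M + 1 ∧ |p 2 t| ≤ M + 1 ∧
        η ^ 2 / 2 ≤ |2 * p 2 t ^ 2 - p 3 t * p 1 t| := by
    intro ε hε t h1 h2
    have hε1 : |ε| = 1 := by rcases hε with rfl | rfl <;> simp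
    have hεt : |t| = ε * t := by
      rw [← abs_of_nonneg (by linarith : 0 ≤ ε * t), abs_mul, hε1, one_mul]
    have ht10 : |t| ≤ 10 := hεt.trans_le h2
    have d1 := hpq 1 (by norm_num) t ht10
    have d2 := hpq 2 (by norm_num) t ht10
    have d3 := hpq 3 (by norm_num) t ht10
    have m1 := hqM 1 (by norm_num) t ht10
    have m2 := hqM 2 (by norm_num) t ht10
    have m3 := hqM 3 (by norm_num) t ht10
    refine ⟨?_, ?_, ?_, ?_⟩
    · have e1 : ε ^ (l - 1) * p 1 t = l * (ε * t) ^ (l - 1) + ε ^ (l - 1) * (p 1 t - q 1 t) := by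
        simp only [hq, Nat.descFactorial_one, mul_pow]; ring
      have e2 : |ε ^ (l - 1) * (p 1 t - q 1 t)| ≤ δ := by
        rw [abs_mul, abs_pow, hε1, one_pow, one_mul]; exact d1
      have e3 := hpow _ h1 (l - 1) (by omega)
      have e4 : (1 : ℝ) ≤ l := by exact_mod_cast (by omega : 1 ≤ l)
      have e5 : η ≤ l * (ε * t) ^ (l - 1) := e3.trans (le_mul_of_one_le_left (hη0.le.trans e3) e4)
      rw [e1]
      linarith [(abs_le.1 e2).1]
    · have : p 1 t = q 1 t + (p 1 t - q 1 t) := by ring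
      rw [this]
      exact (abs_add_le _ _).trans (add_le_add m1 (d1.trans hδ1))
    · have : p 2 t = q 2 t + (p 2 t - q 2 t) := by ring
      rw [this]
      exact (abs_add_le _ _).trans (add_le_add m2 (d2.trans hδ1))
    · have e1 : η ^ 2 ≤ 2 * q 2 t ^ 2 - q 3 t * q 1 t := by
        refine le_trans ?_ (monomial_curvature hl t)
        rw [← sq_abs (t ^ (l - 2)), abs_pow, hεt]
        exact pow_le_pow_left₀ hη0.le (hpow _ h1 _ (by omega)) 2
      have e2 : 2 * p 2 t ^ 2 - p 3 t * p 1 t = (2 * q 2 t ^ 2 - q 3 t * q 1 t) +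
          (2 * ((p 2 t - q 2 t) * (2 * q 2 t + (p 2 t - q 2 t))) -
            ((p 3 t - q 3 t) * (q 1 t + (p 1 t - q 1 t)) + q 3 t * (p 1 t - q 1 t))) := by ring
      have e3 : |(p 2 t - q 2 t) * (2 * q 2 t + (p 2 t - q 2 t))| ≤ δ * (2 * M + 1) := by
        rw [abs_mul]
        refine mul_le_mul d2 ((abs_add_le _ _).trans (add_le_add ?_ (d2.trans hδ1)))
          (abs_nonneg _) hδ0.le
        rw [abs_mul, abs_two]; linarith
      have e4 : |(p 3 t - q 3 t) * (q 1 t + (p 1 t - q 1 t))| ≤ δ * (M + 1) := by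
        rw [abs_mul]
        exact mul_le_mul d3 ((abs_add_le _ _).trans (add_le_add m1 (d1.trans hδ1)))
          (abs_nonneg _) hδ0.le
      have e5 : |q 3 t * (p 1 t - q 1 t)| ≤ M * δ := by
        rw [abs_mul]
        exact mul_le_mul m3 d1 (abs_nonneg _) (by linarith)
      rw [e2]
      refine le_trans ?_ (le_abs_self _)
      have f3 := abs_le.1 e3
      have f4 := abs_le.1 e4
      have f5 := abs_le.1 e5
      nlinarith [f3.1, f4.2, f5.2]
  have mk : ∀ ε : ℝ, (ε = 1 ∨ ε = -1) → ∀ α₀ α β β₀ : ℝ, α₀ < α → α ≤ β → β < β₀ →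
      (∀ t ∈ Set.Ioo α₀ β₀, 1 / 10 ≤ ε * t ∧ ε * t ≤ 10) →
      IsCurved (p 0) (p 1) (p 2) (p 3) (ε ^ (l - 1)) α₀ α β β₀ (η ^ 2 / 2) (M + 1) := by
    intro ε hε α₀ α β β₀ h1 h2 h3 h4
    have hsub : ∀ t ∈ Set.Icc α β, t ∈ Set.Ioo α₀ β₀ := fun t ht =>
      ⟨h1.trans_le ht.1, ht.2.trans_lt h3⟩
    refine ⟨?_, h1, h2, h3, by positivity, fun t => hasStrictDerivAt_polyDeriv _ _ _ t,
      fun t => (hasStrictDerivAt_polyDeriv _ _ _ t).hasDerivAt,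
      fun t => (hasStrictDerivAt_polyDeriv _ _ _ t).hasDerivAt,
      fun t ht => (main ε hε t (h4 t ht).1 (h4 t ht).2).1,
      fun t ht => (main ε hε t (h4 t (hsub t ht)).1 (h4 t (hsub t ht)).2).2.1,
      fun t ht => (main ε hε t (h4 t (hsub t ht)).1 (h4 t (hsub t ht)).2).2.2.1,
      fun t ht => (main ε hε t (h4 t (hsub t ht)).1 (h4 t (hsub t ht)).2).2.2.2⟩
    rw [← pow_mul, mul_comm, pow_mul]
    rcases hε with rfl | rfl <;> simp
  intro σ
  rcases Int.units_eq_one_or σ with rfl | rfl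
  · refine ⟨1 ^ (l - 1), 1 / 10, 1 / 9, 9, 10, mk 1 (Or.inl rfl) _ _ _ _ (by norm_num)
      (by norm_num) (by norm_num) ?_, by norm_num, ?_⟩
    · rintro t ⟨h1, h2⟩; constructor <;> linarith
    · intro t; simp
  · refine ⟨(-1) ^ (l - 1), -10, -9, -(1 / 9), -(1 / 10), mk (-1) (Or.inr rfl) _ _ _ _ (by norm_num)
      (by norm_num) (by norm_num) ?_, by norm_num, ?_⟩
    · rintro t ⟨h1, h2⟩; constructor <;> linarith
    · intro t
      simp only [Set.mem_Icc, Units.val_neg, Units.val_one, Int.cast_neg, Int.cast_one]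
      constructor <;> rintro ⟨h1, h2⟩ <;> constructor <;> linarith

/-! ### The density and the scaling of the polynomial -/

lemma lintegral_comp_mul {S : ℝ} (hS : 0 < S) (f : ℝ → ENNReal) :
    ∫⁻ x, f x = ENNReal.ofReal S * ∫⁻ x, f (S * x) := by
  have h1 := (measurableEmbedding_mulLeft₀ hS.ne').lintegral_map f (μ := volume)
  rw [Real.map_volume_mul_left hS.ne', lintegral_smul_measure, abs_of_pos (inv_pos.2 hS)] at h1
  rw [← h1, smul_eq_mul, ← mul_assoc, ← ENNReal.ofReal_mul hS.le, mul_inv_cancel₀ hS.ne',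
    ENNReal.ofReal_one, one_mul]

/-- The density `ρ_σ(t) = θ_σ(t) / t`. -/
noncomputable def density (θ : ℝ → ℝ) (σ : ℤˣ) (t : ℝ) : ℝ := signed θ σ t / t

lemma IsDyadicCutoff.continuous {ψ : ℝ → ℝ} {s : Set ℝ} (h : IsDyadicCutoff ψ s) : Continuous ψ :=
  h.smooth.continuous

lemma signed_eq_zero {ψ : ℝ → ℝ} {s : Set ℝ} (h : IsDyadicCutoff ψ s) {σ : ℤˣ} {t : ℝ}
    (ht : ((σ : ℤ) : ℝ) * t ∉ s) : signed ψ σ t = 0 := by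
  by_contra hne
  exact ht (h.support_subset hne)

lemma continuous_signed {ψ : ℝ → ℝ} {s : Set ℝ} (h : IsDyadicCutoff ψ s) (σ : ℤˣ) :
    Continuous (signed ψ σ) := h.continuous.comp (continuous_const.mul continuous_id)

lemma abs_unit (σ : ℤˣ) : |((σ : ℤ) : ℝ)| = 1 := by
  rcases Int.units_eq_one_or σ with rfl | rfl <;> simp

lemma abs_unit_mul (σ : ℤˣ) (t : ℝ) : |((σ : ℤ) : ℝ) * t| = |t| := by
  rw [abs_mul, abs_unit, one_mul]

section density

variable {θ : ℝ → ℝ} (hθ : IsDyadicCutoff θ (Set.Ioo (1 / 9) 9)) (σ : ℤˣ)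
include hθ

lemma density_eq_zero {t : ℝ} (ht : ((σ : ℤ) : ℝ) * t ∉ Set.Icc (1 / 9 : ℝ) 9) :
    density θ σ t = 0 := by
  rw [density, signed_eq_zero hθ fun h => ht (Set.Ioo_subset_Icc_self h), zero_div]

lemma contDiff_density : ContDiff ℝ 1 (density θ σ) := by
  rw [contDiff_iff_contDiffAt]
  intro t
  by_cases ht : t = 0
  · subst ht
    have : density θ σ =ᶠ[nhds 0] fun _ => 0 := by
      filter_upwards [Metric.ball_mem_nhds (0 : ℝ) (by norm_num : (0 : ℝ) < 1 / 9)] with x hx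
      apply density_eq_zero hθ
      rintro ⟨h1, -⟩
      rw [Metric.mem_ball, dist_zero_right, Real.norm_eq_abs, ← abs_unit_mul σ] at hx
      linarith [le_abs_self (((σ : ℤ) : ℝ) * x)]
    exact contDiffAt_const.congr_of_eventuallyEq this
  · have h1 : ContDiff ℝ 1 (signed θ σ) :=
      (hθ.smooth.of_le (by exact_mod_cast le_top)).comp (contDiff_const.mul contDiff_id)
    exact h1.contDiffAt.div contDiffAt_id ht

lemma hasCompactSupport_density : HasCompactSupport (density θ σ) := by
  refine HasCompactSupport.intro (K := Set.Icc (-9) 9) isCompact_Icc fun t ht => ?_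
  apply density_eq_zero hθ
  rintro ⟨h1, h2⟩
  apply ht
  have h3 : |t| ≤ 9 := by
    rw [← abs_unit_mul σ, abs_of_nonneg (by linarith)]; exact h2
  exact abs_le.1 h3

lemma exists_density_bound : ∃ B : ℝ, ∀ σ : ℤˣ, ∀ t, |density θ σ t| ≤ B ∧
    |deriv (density θ σ) t| ≤ B := by
  have h : ∀ σ : ℤˣ, ∃ B : ℝ, ∀ t, |density θ σ t| ≤ B ∧ |deriv (density θ σ) t| ≤ B := by
    intro σ
    obtain ⟨B1, h1⟩ := (hasCompactSupport_density hθ σ).exists_bound_of_continuous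
      (contDiff_density hθ σ).continuous
    obtain ⟨B2, h2⟩ := (hasCompactSupport_density hθ σ).deriv.exists_bound_of_continuous
      ((contDiff_density hθ σ).continuous_deriv le_rfl)
    exact ⟨max B1 B2, fun t => ⟨(h1 t).trans (le_max_left _ _), (h2 t).trans (le_max_right _ _)⟩⟩
  choose B hB using h
  refine ⟨max (B 1) (B (-1)), fun σ t => ?_⟩
  rcases Int.units_eq_one_or σ with rfl | rfl
  · exact ⟨(hB 1 t).1.trans (le_max_left _ _), (hB 1 t).2.trans (le_max_left _ _)⟩
  · exact ⟨(hB (-1) t).1.trans (le_max_right _ _), (hB (-1) t).2.trans (le_max_right _ _)⟩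

end density

/-- The factor `2^{-jl}` is removed by a dilation in `x`, leaving a polynomial whose `t^l`
coefficient is still `a l`. This is why the single-scale constants are independent of `j`. -/
lemma poly_scaling (N l : ℕ) (a : ℕ → ℝ) (j : ℤ) (t : ℝ) :
    poly N a ((2 : ℝ) ^ (-j) * t) = (2 : ℝ) ^ (-(j * (l : ℤ))) *
      polyDeriv (Finset.Icc 2 N) (fun i => a i * (2 : ℝ) ^ (j * (l : ℤ) - j * (i : ℤ))) 0 t := by
  unfold poly polyDeriv
  rw [Finset.mul_sum]
  refine Finset.sum_congr rfl fun i _ => ?_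
  rw [Nat.descFactorial_zero, Nat.sub_zero, Nat.cast_one, one_mul, mul_pow, ← zpow_natCast,
    ← zpow_mul]
  have : (2 : ℝ) ^ (-j * (i : ℤ)) =
      (2 : ℝ) ^ (-(j * (l : ℤ))) * (2 : ℝ) ^ (j * (l : ℤ) - j * (i : ℤ)) := by
    rw [← zpow_add₀ two_ne_zero]; congr 1; ring
  rw [this]; ring

/-- Multiplying the dominance condition by `2^{jl}` says exactly that the normalised lower and
higher coefficients are small. -/
lemma abs_coeff_le {N l : ℕ} {K K₀ : ℝ} {a : ℕ → ℝ} {j : ℤ} (hK₀ : 0 < K₀) (hK : K₀ ≤ K)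
    (hal : a l = 1) (hj : j ∈ dominatingSet N K a l) {i : ℕ} (hi : i ∈ Finset.Icc 2 N)
    (hil : i ≠ l) : |a i * (2 : ℝ) ^ (j * (l : ℤ) - j * (i : ℤ))| ≤ 1 / K₀ := by
  obtain ⟨h2, hN⟩ := Finset.mem_Icc.1 hi
  have h := hj.2 i h2 hN hil
  rw [hal, abs_one, one_mul] at h
  have hp : (0 : ℝ) < (2 : ℝ) ^ (j * (l : ℤ)) := by positivity
  have h3 := mul_lt_mul_of_pos_right h hp
  rw [← zpow_add₀ two_ne_zero, neg_add_cancel, zpow_zero] at h3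
  rw [abs_mul, abs_of_pos (by positivity : (0 : ℝ) < (2 : ℝ) ^ (j * (l : ℤ) - j * (i : ℤ))),
    le_div_iff₀ hK₀]
  have e : (2 : ℝ) ^ (j * (l : ℤ) - j * (i : ℤ)) = (2 : ℝ) ^ (-(j * (i : ℤ))) * 2 ^ (j * (l : ℤ)) := by
    rw [← zpow_add₀ two_ne_zero]; congr 1; ring
  rw [e]
  have hnn : 0 ≤ |a i| * ((2 : ℝ) ^ (-(j * (i : ℤ))) * 2 ^ (j * (l : ℤ))) := by positivity
  calc _ ≤ |a i| * ((2 : ℝ) ^ (-(j * (i : ℤ))) * 2 ^ (j * (l : ℤ))) * K :=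
        mul_le_mul_of_nonneg_left hK hnn
    _ = K * (|a i| * (2 : ℝ) ^ (-(j * (i : ℤ)))) * 2 ^ (j * (l : ℤ)) := by ring
    _ ≤ 1 := h3.le

/-- The `L²` estimate at the scale `j`. -/
theorem exists_single_scale_bound (N : ℕ) (hN : 2 ≤ N) : ∃ K₀ > (0 : ℝ), ∀ θ : ℝ → ℝ,
    IsDyadicCutoff θ (Set.Ioo (1 / 9) 9) → ∀ BW > (0 : ℝ), ∃ D > (0 : ℝ), ∀ K, K₀ ≤ K →
    ∀ l : ℕ, 2 ≤ l → l ≤ N → ∀ a : ℕ → ℝ, a l = 1 → ∀ j ∈ dominatingSet N K a l, ∀ σ : ℤˣ,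
    ∀ W : ℝ → ℂ, Measurable W → (∀ x, ‖W x‖ ≤ BW) → ∀ v : ℝ → ℝ, Measurable v →
    ∀ Λ > (0 : ℝ), (∀ x, W x ≠ 0 → Λ ≤ |v x|) → ∀ g : ℝ → ℂ, Measurable g →
    ∀ Mg : ℝ, (∀ z, ‖g z‖ ≤ Mg) →
    ∫⁻ x, ‖W x * ∫ t, (density θ σ t : ℂ) * e (v x * t) *
      g (x + poly N a ((2 : ℝ) ^ (-j) * t))‖ₑ ^ 2 ≤
      ENNReal.ofReal (D / Real.sqrt Λ) * ∫⁻ z, ‖g z‖ₑ ^ 2 := by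
  obtain ⟨K₀, hK₀, c, hc, C, hC, H⟩ := exists_isCurved N hN
  refine ⟨K₀, hK₀, fun θ hθ BW hBW => ?_⟩
  obtain ⟨B, hB⟩ := exists_density_bound hθ
  refine ⟨scaleConst B c C (9 - 1 / 9) BW, scaleConst_pos hc hC (by norm_num) hBW, ?_⟩
  intro K hK l hl hlN a hal j hj σ W hW hWb v hv Λ hΛ hWv g hg Mg hMg
  set b : ℕ → ℝ := fun i => a i * (2 : ℝ) ^ (j * (l : ℤ) - j * (i : ℤ)) with hb
  obtain ⟨s, α₀, α, β, β₀, hcur, hlen, hmem⟩ := H l hl hlN b (by simp [hb, hal])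
    (fun i hi hil => abs_coeff_le hK₀ hK hal hj hi hil) σ
  set S : ℝ := (2 : ℝ) ^ (-(j * (l : ℤ))) with hS
  have hS0 : 0 < S := by positivity
  have hcd := contDiff_density hθ σ
  have key := hcur.lintegral_sq_le (ρ := density θ σ) (ρ1 := deriv (density θ σ))
    hcd.continuous (fun t ht => density_eq_zero hθ σ fun h => ht ((hmem t).2 h))
    (fun t _ => (hcd.differentiable one_ne_zero t).hasDerivAt)
    (hcd.continuous_deriv le_rfl) (fun t _ => (hB σ t).1) (fun t _ => (hB σ t).2)
    (W := fun x => W (S * x)) (hW.comp (measurable_const_mul S)) hBW (fun x => hWb _)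
    (v := fun x => v (S * x)) (hv.comp (measurable_const_mul S)) hΛ (fun x => hWv _)
    (g := fun x => g (S * x)) (hg.comp (measurable_const_mul S)) (Mg := Mg) (fun z => hMg _)
  -- Dilating `x` by `S` multiplies both squared norms by the same factor, so the constant is
  -- unchanged.
  rw [lintegral_comp_mul hS0, lintegral_comp_mul hS0 (fun z => ‖g z‖ₑ ^ 2), mul_left_comm]
  rw [hlen] at key
  refine mul_le_mul_right ?_ _
  simp_rw [poly_scaling N l a j, ← hS, ← mul_add]
  exact key

/-! ### Dyadic localisation -/

lemma measurable_tsum_of_summable {ι X : Type*} [Countable ι] [MeasurableSpace X] {f : ι → X → ℂ}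
    (hf : ∀ i, Measurable (f i)) (hs : ∀ x, Summable fun i => f i x) :
    Measurable fun x => ∑' i, f i x := by
  refine measurable_of_tendsto_metrizable' (f := fun (s : Finset ι) x => ∑ i ∈ s, f i x)
    Filter.atTop (fun s => Finset.measurable_fun_sum s fun i _ => hf i) ?_
  rw [tendsto_pi_nhds]
  exact fun x => (hs x).hasSum

/-- The strict inequality `|c| < 2^(log + 1)` keeps the window symmetric, with `2r + 1` elements.
The case `r = 1` serves one cutoff and `r = 2` a product of two. -/
lemma mem_Icc_log {c : ℝ} (hc : c ≠ 0) {k : ℤ} {r : ℕ} (h1 : |c| ≤ (2 : ℝ) ^ r * 2 ^ k)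
    (h2 : (2 : ℝ) ^ k ≤ 2 ^ r * |c|) :
    k ∈ Finset.Icc (Int.log 2 |c| - r) (Int.log 2 |c| + r) := by
  have hc' := abs_pos.2 hc
  have h3 : (2 : ℝ) ^ Int.log 2 |c| ≤ |c| := by exact_mod_cast Int.zpow_log_le_self one_lt_two hc'
  have h4 : |c| < (2 : ℝ) ^ (Int.log 2 |c| + 1) := by
    exact_mod_cast Int.lt_zpow_succ_log_self (b := 2) one_lt_two |c|
  rw [Finset.mem_Icc]
  constructor
  · have : (2 : ℝ) ^ Int.log 2 |c| ≤ 2 ^ ((r : ℤ) + k) := by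
      rw [zpow_add₀ two_ne_zero, zpow_natCast]; exact h3.trans h1
    have := (zpow_le_zpow_iff_right₀ (one_lt_two : (1 : ℝ) < 2)).1 this
    linarith
  · have : (2 : ℝ) ^ k < 2 ^ ((r : ℤ) + (Int.log 2 |c| + 1)) := by
      rw [zpow_add₀ two_ne_zero, zpow_natCast]
      exact h2.trans_lt (mul_lt_mul_of_pos_left h4 (by positivity))
    have := (zpow_lt_zpow_iff_right₀ (one_lt_two : (1 : ℝ) < 2)).1 this
    omega

section cutoff

variable {Φ : ℝ → ℝ} (hΦ : IsDyadicCutoff Φ (Set.Icc (1 / 2) 2))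
include hΦ

lemma abs_mem_of_signed_ne_zero {σ : ℤˣ} {c : ℝ} {k : ℤ} (h : signed Φ σ (c / 2 ^ k) ≠ 0) :
    2 ^ k / 2 ≤ |c| ∧ |c| ≤ 2 * 2 ^ k := by
  have hk : (0 : ℝ) < 2 ^ k := by positivity
  have hm : ((σ : ℤ) : ℝ) * (c / 2 ^ k) ∈ Set.Icc (1 / 2 : ℝ) 2 := by
    by_contra hcon; exact h (signed_eq_zero hΦ hcon)
  have habs : |c| / 2 ^ k = ((σ : ℤ) : ℝ) * (c / 2 ^ k) := by
    rw [← abs_of_nonneg ((by norm_num : (0 : ℝ) ≤ 1 / 2).trans hm.1), abs_unit_mul, abs_div,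
      abs_of_pos hk]
  rw [← habs] at hm
  exact ⟨by have := (le_div_iff₀ hk).1 hm.1; linarith, (div_le_iff₀ hk).1 hm.2⟩

lemma mem_window_of_signed_ne_zero {σ : ℤˣ} {c : ℝ} {k : ℤ} (h : signed Φ σ (c / 2 ^ k) ≠ 0) :
    k ∈ Finset.Icc (Int.log 2 |c| - 1) (Int.log 2 |c| + 1) := by
  obtain ⟨h1, h2⟩ := abs_mem_of_signed_ne_zero hΦ h
  have hk : (0 : ℝ) < 2 ^ k := by positivity
  have hc : c ≠ 0 := by rintro rfl; simp at h1; linarith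
  exact mem_Icc_log (r := 1) hc (by simpa using h2) (by linarith)

lemma exists_cutoff_bound : ∃ B > (0 : ℝ), ∀ t, |Φ t| ≤ B := by
  have hs : HasCompactSupport Φ := HasCompactSupport.intro isCompact_Icc fun t ht => by
    by_contra h; exact ht (hΦ.support_subset h)
  obtain ⟨B, hB⟩ := hs.exists_bound_of_continuous hΦ.continuous
  exact ⟨|B| + 1, by positivity, fun t => (hB t).trans ((le_abs_self B).trans (by linarith))⟩

omit hΦ in
lemma card_window (n : ℤ) (r : ℕ) : (Finset.Icc (n - r) (n + r)).card = 2 * r + 1 := by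
  rw [Int.card_Icc]; omega

/-- The dyadic dilates of the cutoff overlap boundedly. -/
lemma tsum_signed_sq_le {B : ℝ} (hB : ∀ t, |Φ t| ≤ B) (σ : ℤˣ) (c : ℝ) {l : ℕ} (hl : l ≠ 0)
    (m : ℕ) : ∑' j : ℤ, ‖signed Φ σ (c / 2 ^ (j * (l : ℤ) + (m : ℤ)))‖ₑ ^ 2 ≤
      ENNReal.ofReal (3 * B ^ 2) := by
  -- The exponents `jl + m` are distinct, so the sum is dominated by the sum over all dyadic scales,
  -- of which at most three meet a given `c`.
  have hinj : Function.Injective fun j : ℤ => j * (l : ℤ) + (m : ℤ) := fun i j h => by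
    have h' : i * (l : ℤ) = j * (l : ℤ) := by simpa using h
    exact mul_right_cancel₀ (by exact_mod_cast hl) h'
  refine (ENNReal.tsum_comp_le_tsum_of_injective hinj
    fun k : ℤ => ‖signed Φ σ (c / 2 ^ k)‖ₑ ^ 2).trans ?_
  rw [tsum_eq_sum (s := Finset.Icc (Int.log 2 |c| - (1 : ℕ)) (Int.log 2 |c| + (1 : ℕ)))]
  · calc _ ≤ ∑ k ∈ Finset.Icc (Int.log 2 |c| - (1 : ℕ)) (Int.log 2 |c| + (1 : ℕ)),
          ENNReal.ofReal (B ^ 2) := by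
          refine Finset.sum_le_sum fun k _ => ?_
          rw [← ofReal_norm, ← ENNReal.ofReal_pow (norm_nonneg _)]
          exact ENNReal.ofReal_le_ofReal (pow_le_pow_left₀ (norm_nonneg _) (hB _) 2)
      _ = _ := by
          rw [Finset.sum_const, card_window, nsmul_eq_mul, ENNReal.ofReal_mul (by norm_num)]
          norm_num
  · intro k hk
    by_contra hne
    apply hk
    have : signed Φ σ (c / 2 ^ k) ≠ 0 := fun h0 => hne (by simp [h0])
    simpa using mem_window_of_signed_ne_zero hΦ this

end cutoff

/-! ### Structure and boundedness of the symbol -/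

/-- The part of the symbol that depends on `u(x)` and `η` only through the cutoffs. -/
noncomputable def fiberCut (Φ : ℝ → ℝ) (σ : Fin 4 → ℤˣ) (m : ℕ) (j : ℤ) (v η : ℝ) : ℝ :=
  ∑' k : ℤ, signed Φ (σ 1) (η / (2 : ℝ) ^ k) * signed Φ (σ 2) (v / (2 : ℝ) ^ (j - k + (m : ℤ)))

/-- Neither the cutoff in `ξ` nor the oscillatory integral involves `k`. The sum over `k` is thus a
weight in `u(x)` and `η` alone, which can be taken out of the `ξ` integral. -/
lemma symbol_eq (θ Φ : ℝ → ℝ) (N l : ℕ) (a : ℕ → ℝ) (σ : Fin 4 → ℤˣ) (m : ℕ) (j : ℤ) (v : ℝ)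
    (ζ : ℝ × ℝ) : symbol θ Φ N l a σ m j v ζ =
      (fiberCut Φ σ m j v ζ.2 : ℂ) *
        ((signed Φ (σ 0) (ζ.1 / (2 : ℝ) ^ (j * (l : ℤ) + (m : ℤ))) : ℂ) *
          oscillatory θ N a (σ 3) j v ζ) := by
  unfold symbol fiberCut
  rw [tsum_mul_right, ← Complex.ofReal_tsum]
  simp_rw [mul_assoc, tsum_mul_left]
  push_cast
  ring

section fiberCut

variable {Φ : ℝ → ℝ} (hΦ : IsDyadicCutoff Φ (Set.Icc (1 / 2) 2)) (σ : Fin 4 → ℤˣ) (m : ℕ) (j : ℤ)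
include hΦ

lemma fiberCut_eq_sum (v η : ℝ) : fiberCut Φ σ m j v η =
    ∑ k ∈ Finset.Icc (Int.log 2 |η| - (1 : ℕ)) (Int.log 2 |η| + (1 : ℕ)),
      signed Φ (σ 1) (η / (2 : ℝ) ^ k) * signed Φ (σ 2) (v / (2 : ℝ) ^ (j - k + (m : ℤ))) := by
  refine tsum_eq_sum fun k hk => ?_
  by_contra hne
  exact hk (by simpa using mem_window_of_signed_ne_zero hΦ (left_ne_zero_of_mul hne))

lemma abs_fiberCut_le {B : ℝ} (hB : ∀ t, |Φ t| ≤ B) (v η : ℝ) :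
    |fiberCut Φ σ m j v η| ≤ 3 * B ^ 2 := by
  rw [fiberCut_eq_sum hΦ]
  refine (Finset.abs_sum_le_sum_abs _ _).trans ?_
  calc _ ≤ ∑ k ∈ Finset.Icc (Int.log 2 |η| - (1 : ℕ)) (Int.log 2 |η| + (1 : ℕ)), B * B := by
        refine Finset.sum_le_sum fun k _ => ?_
        rw [abs_mul]
        exact mul_le_mul (hB _) (hB _) (abs_nonneg _) ((abs_nonneg _).trans (hB 0))
    _ = _ := by
        rw [Finset.sum_const, card_window, nsmul_eq_mul]; push_cast; ring

lemma measurable_fiberCut : Measurable fun q : ℝ × ℝ => fiberCut Φ σ m j q.1 q.2 := by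
  have h : Measurable fun q : ℝ × ℝ => ∑' k : ℤ,
      ((signed Φ (σ 1) (q.2 / (2 : ℝ) ^ k) *
        signed Φ (σ 2) (q.1 / (2 : ℝ) ^ (j - k + (m : ℤ))) : ℝ) : ℂ) := by
    refine measurable_tsum_of_summable (fun k => ?_) fun q => ?_
    · exact Complex.measurable_ofReal.comp
        (((continuous_signed hΦ _).measurable.comp (measurable_snd.div_const _)).mul
          ((continuous_signed hΦ _).measurable.comp (measurable_fst.div_const _)))
    · refine summable_of_ne_finset_zero
        (s := Finset.Icc (Int.log 2 |q.2| - (1 : ℕ)) (Int.log 2 |q.2| + (1 : ℕ))) fun k hk => ?_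
      by_contra hne
      rw [Complex.ofReal_eq_zero] at hne
      exact hk (by simpa using mem_window_of_signed_ne_zero hΦ (left_ne_zero_of_mul hne))
  have heq : (fun q : ℝ × ℝ => fiberCut Φ σ m j q.1 q.2) = fun q => (∑' k : ℤ,
      ((signed Φ (σ 1) (q.2 / (2 : ℝ) ^ k) *
        signed Φ (σ 2) (q.1 / (2 : ℝ) ^ (j - k + (m : ℤ))) : ℝ) : ℂ)).re := by
    ext q
    rw [← Complex.ofReal_tsum, Complex.ofReal_re, fiberCut]
  rw [heq]
  exact Complex.measurable_re.comp h

/-- Multiplying `|η| ≈ 2^k` by `|v| ≈ 2^{j-k+m}` eliminates `k`. The lower bound supplies the large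
parameter `2^m / 4` of the oscillation; the two bounds together localise `j`. -/
lemma of_fiberCut_ne_zero {v η : ℝ} (h : fiberCut Φ σ m j v η ≠ 0) :
    (2 : ℝ) ^ (j + (m : ℤ)) / 4 ≤ |η * v| ∧ |η * v| ≤ 4 * (2 : ℝ) ^ (j + (m : ℤ)) := by
  rw [fiberCut_eq_sum hΦ] at h
  obtain ⟨k, -, hk⟩ := Finset.exists_ne_zero_of_sum_ne_zero h
  obtain ⟨h1, h2⟩ := abs_mem_of_signed_ne_zero hΦ (left_ne_zero_of_mul hk)
  obtain ⟨h3, h4⟩ := abs_mem_of_signed_ne_zero hΦ (right_ne_zero_of_mul hk)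
  have e : (2 : ℝ) ^ (j + (m : ℤ)) = 2 ^ k * 2 ^ (j - k + (m : ℤ)) := by
    rw [← zpow_add₀ two_ne_zero]; congr 1; ring
  have p1 : (0 : ℝ) < 2 ^ k := by positivity
  have p2 : (0 : ℝ) < 2 ^ (j - k + (m : ℤ)) := by positivity
  rw [e, abs_mul]
  constructor
  · calc _ = (2 ^ k / 2) * (2 ^ (j - k + (m : ℤ)) / 2) := by ring
      _ ≤ _ := mul_le_mul h1 h3 (by positivity) (abs_nonneg _)
  · calc _ ≤ (2 * 2 ^ k) * (2 * 2 ^ (j - k + (m : ℤ))) := mul_le_mul h2 h4 (abs_nonneg _) (by positivity)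
      _ = _ := by ring

omit j in
-- `j + m` lies within 2 of the integer part of the binary logarithm of `|η v|`, which leaves five
-- values. The window does not depend on `ξ`, so it can be fixed before integrating in `ξ`.
lemma exists_scale_window (c : ℝ) : ∃ J : Finset ℤ, J.card = 5 ∧ ∀ j : ℤ, ∀ v η : ℝ, η * v = c →
    fiberCut Φ σ m j v η ≠ 0 → j ∈ J := by
  refine ⟨Finset.Icc ((Int.log 2 |c| - m) - (2 : ℕ)) ((Int.log 2 |c| - m) + (2 : ℕ)),
    card_window _ _, fun j v η hc h => ?_⟩
  obtain ⟨h1, h2⟩ := of_fiberCut_ne_zero hΦ σ m j h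
  rw [hc] at h1 h2
  have hp : (0 : ℝ) < 2 ^ (j + (m : ℤ)) := by positivity
  have hc0 : c ≠ 0 := by rintro rfl; simp at h1; linarith
  have := mem_Icc_log (r := 2) (k := j + m) hc0 (by norm_num; linarith) (by norm_num; linarith)
  rw [Finset.mem_Icc] at this ⊢
  push_cast at this ⊢
  constructor <;> linarith [this.1, this.2]

end fiberCut

/-- The `ξ` part of the phase is isolated because, after inversion in `ξ`, it becomes the
translation of `x` by `P(2^{-j} t)`. -/
lemma oscillatory_eq (θ : ℝ → ℝ) (N : ℕ) (a : ℕ → ℝ) (σ : ℤˣ) (j : ℤ) (v : ℝ) (ζ : ℝ × ℝ) :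
    oscillatory θ N a σ j v ζ = ∫ t, e (ζ.1 * poly N a ((2 : ℝ) ^ (-j) * t)) *
      ((density θ σ t : ℂ) * e (ζ.2 * v * (2 : ℝ) ^ (-j) * t)) := by
  unfold oscillatory
  congr 1; ext t
  rw [phase, e_add, density]; ring

lemma continuous_poly (N : ℕ) (a : ℕ → ℝ) : Continuous (poly N a) := by
  unfold poly; fun_prop

lemma norm_oscillatory_le (θ : ℝ → ℝ) (N : ℕ) (a : ℕ → ℝ) (σ : ℤˣ) (j : ℤ) (v : ℝ) (ζ : ℝ × ℝ) :
    ‖oscillatory θ N a σ j v ζ‖ ≤ ∫ t, ‖density θ σ t‖ := by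
  rw [oscillatory_eq]
  refine (norm_integral_le_integral_norm _).trans_eq ?_
  simp

/-- A crude bound without decay in `m`; it only serves absolute convergence and Fubini. -/
lemma exists_symbol_bound {Φ : ℝ → ℝ} (θ : ℝ → ℝ) (hΦ : IsDyadicCutoff Φ (Set.Icc (1 / 2) 2)) : ∃ A : ℝ,
    ∀ (N l : ℕ) (a : ℕ → ℝ) (σ : Fin 4 → ℤˣ) (m : ℕ) (j : ℤ) (v : ℝ) (ζ : ℝ × ℝ),
      ‖symbol θ Φ N l a σ m j v ζ‖ ≤ A := by
  obtain ⟨B, hB0, hB⟩ := exists_cutoff_bound hΦ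
  refine ⟨3 * B ^ 2 * (B * ((∫ t, ‖density θ 1 t‖) + ∫ t, ‖density θ (-1) t‖)),
    fun N l a σ m j v ζ => ?_⟩
  rw [symbol_eq, norm_mul, norm_mul, Complex.norm_real, Complex.norm_real]
  have h1 : 0 ≤ ∫ t, ‖density θ 1 t‖ := integral_nonneg fun _ => norm_nonneg _
  have h2 : 0 ≤ ∫ t, ‖density θ (-1) t‖ := integral_nonneg fun _ => norm_nonneg _
  refine mul_le_mul (abs_fiberCut_le hΦ σ m j hB _ _) (mul_le_mul (hB _)
    ((norm_oscillatory_le θ N a (σ 3) j v ζ).trans ?_) (norm_nonneg _) hB0.le) (by positivity)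
    (by positivity)
  rcases Int.units_eq_one_or (σ 3) with h | h <;> rw [h] <;> linarith

section symbol

variable {θ Φ : ℝ → ℝ} (hθ : IsDyadicCutoff θ (Set.Ioo (1 / 9) 9))
include hθ

lemma integrable_density (σ : ℤˣ) : Integrable (density θ σ) :=
  (contDiff_density hθ σ).continuous.integrable_of_hasCompactSupport
    (hasCompactSupport_density hθ σ)

lemma measurable_oscillatory (N : ℕ) (a : ℕ → ℝ) (σ : ℤˣ) (j : ℤ) :
    Measurable fun q : ℝ × (ℝ × ℝ) => oscillatory θ N a σ j q.1 q.2 := by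
  simp_rw [oscillatory_eq]
  have hc := continuous_poly N a
  have hd := (contDiff_density hθ σ).continuous
  have : Continuous (Function.uncurry fun (q : ℝ × (ℝ × ℝ)) (t : ℝ) =>
      e (q.2.1 * poly N a ((2 : ℝ) ^ (-j) * t)) *
        ((density θ σ t : ℂ) * e (q.2.2 * q.1 * (2 : ℝ) ^ (-j) * t))) :=
    (continuous_e.comp (by fun_prop)).mul
      ((Complex.continuous_ofReal.comp (hd.comp continuous_snd)).mul
        (continuous_e.comp (by fun_prop)))
  exact (this.stronglyMeasurable.integral_prod_right (ν := volume)).measurable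

lemma measurable_symbol (hΦ : IsDyadicCutoff Φ (Set.Icc (1 / 2) 2)) (N l : ℕ) (a : ℕ → ℝ)
    (σ : Fin 4 → ℤˣ) (m : ℕ) (j : ℤ) :
    Measurable fun q : ℝ × (ℝ × ℝ) => symbol θ Φ N l a σ m j q.1 q.2 := by
  simp_rw [symbol_eq]
  refine (Complex.measurable_ofReal.comp ((measurable_fiberCut hΦ σ m j).comp
    (by fun_prop : Measurable fun q : ℝ × (ℝ × ℝ) => (q.1, q.2.2)))).mul
    (Measurable.mul ?_ (measurable_oscillatory hθ N a (σ 3) j))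
  exact (Complex.continuous_ofReal.comp ((continuous_signed hΦ _).comp
    (by fun_prop : Continuous fun q : ℝ × (ℝ × ℝ) =>
      q.2.1 / (2 : ℝ) ^ (j * (l : ℤ) + (m : ℤ))))).measurable

/-- The sum over the scales is a bounded measurable symbol. -/
lemma exists_tsum_symbol_bound (hΦ : IsDyadicCutoff Φ (Set.Icc (1 / 2) 2)) : ∃ A : ℝ,
    ∀ (N l : ℕ) (a : ℕ → ℝ) (S : Set ℤ) (σ : Fin 4 → ℤˣ) (m : ℕ),
      (Measurable fun q : ℝ × (ℝ × ℝ) => ∑' j : S, symbol θ Φ N l a σ m (j : ℤ) q.1 q.2) ∧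
      ∀ (v : ℝ) (ζ : ℝ × ℝ), ‖∑' j : S, symbol θ Φ N l a σ m (j : ℤ) v ζ‖ ≤ A := by
  obtain ⟨A, hA⟩ := exists_symbol_bound θ hΦ
  refine ⟨5 * A, fun N l a S σ m => ?_⟩
  have hout : ∀ v (ζ : ℝ × ℝ), ∃ J : Finset ℤ, J.card = 5 ∧ ∀ j ∉ J,
      S.indicator (fun j => symbol θ Φ N l a σ m j v ζ) j = 0 := by
    intro v ζ
    obtain ⟨J, hJ5, hJ⟩ := exists_scale_window hΦ σ m (ζ.2 * v)
    refine ⟨J, hJ5, fun j hj => ?_⟩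
    have h0 : fiberCut Φ σ m j v ζ.2 = 0 := by
      by_contra hne; exact hj (hJ j _ _ rfl hne)
    refine Set.indicator_apply_eq_zero.2 fun _ => ?_
    rw [symbol_eq, h0]; simp
  have hts : ∀ v (ζ : ℝ × ℝ), ∑' j : S, symbol θ Φ N l a σ m (j : ℤ) v ζ =
      ∑' j : ℤ, S.indicator (fun j => symbol θ Φ N l a σ m j v ζ) j := fun v ζ =>
    tsum_subtype S fun j => symbol θ Φ N l a σ m j v ζ
  simp_rw [hts]
  constructor
  · refine measurable_tsum_of_summable (fun j => ?_) fun q => ?_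
    · by_cases hj : j ∈ S
      · simp only [Set.indicator_of_mem hj]
        exact measurable_symbol hθ hΦ N l a σ m j
      · simp only [Set.indicator_of_notMem hj]; exact measurable_const
    · obtain ⟨J, -, hJ⟩ := hout q.1 q.2
      exact summable_of_ne_finset_zero hJ
  · intro v ζ
    obtain ⟨J, hJ5, hJ⟩ := hout v ζ
    rw [tsum_eq_sum hJ]
    refine (norm_sum_le_of_le J (f := fun j => S.indicator
      (fun j => symbol θ Φ N l a σ m j v ζ) j) (n := fun _ => A) fun j _ => ?_).trans_eq ?_
    · exact (norm_indicator_le_norm_self _ _).trans (hA N l a σ m j v ζ)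
    · rw [Finset.sum_const, hJ5, nsmul_eq_mul]; norm_num

end symbol

/-! ### The fibre operators at fixed `η` -/

/-- Fubini: a single scale in physical space. -/
lemma integral_symbol_eq {θ Φ : ℝ → ℝ} (hθ : IsDyadicCutoff θ (Set.Ioo (1 / 9) 9))
    (N l : ℕ) (a : ℕ → ℝ) (σ : Fin 4 → ℤˣ) (m : ℕ) (j : ℤ) (v η x : ℝ) {h : ℝ → ℂ}
    (hh : Integrable fun ξ =>
      h ξ * (signed Φ (σ 0) (ξ / (2 : ℝ) ^ (j * (l : ℤ) + (m : ℤ))) : ℂ)) :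
    ∫ ξ, h ξ * e (ξ * x) * symbol θ Φ N l a σ m j v (ξ, η) =
      (fiberCut Φ σ m j v η : ℂ) * ∫ t, (density θ (σ 3) t : ℂ) * e (η * v * (2 : ℝ) ^ (-j) * t) *
        ∫ ξ, h ξ * (signed Φ (σ 0) (ξ / (2 : ℝ) ^ (j * (l : ℤ) + (m : ℤ))) : ℂ) *
          e (ξ * (x + poly N a ((2 : ℝ) ^ (-j) * t))) := by
  set G : ℝ → ℂ := fun ξ =>
    h ξ * (signed Φ (σ 0) (ξ / (2 : ℝ) ^ (j * (l : ℤ) + (m : ℤ))) : ℂ) with hG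
  have e1 : ∀ ξ, h ξ * e (ξ * x) * symbol θ Φ N l a σ m j v (ξ, η) =
      (fiberCut Φ σ m j v η : ℂ) * ∫ t, G ξ * e (ξ * (x + poly N a ((2 : ℝ) ^ (-j) * t))) *
        ((density θ (σ 3) t : ℂ) * e (η * v * (2 : ℝ) ^ (-j) * t)) := by
    intro ξ
    rw [symbol_eq, oscillatory_eq]
    simp_rw [mul_add, e_add, mul_assoc, integral_const_mul]
    simp only [hG]
    ring
  simp_rw [e1]
  rw [integral_const_mul, integral_integral_swap]
  · congr 2; ext t
    rw [integral_mul_const]; ring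
  · have hd : Integrable fun t => (density θ (σ 3) t : ℂ) :=
      (integrable_density hθ (σ 3)).ofReal
    have hc := continuous_poly N a
    have h3 : Integrable (fun z : ℝ × ℝ => (G z.1 * (density θ (σ 3) z.2 : ℂ)) *
        (e (z.1 * (x + poly N a ((2 : ℝ) ^ (-j) * z.2))) * e (η * v * (2 : ℝ) ^ (-j) * z.2)))
          (volume.prod volume) :=
      (hh.mul_prod hd).mul_bdd (c := 1)
        ((continuous_e.comp (by fun_prop)).mul
          (continuous_e.comp (by fun_prop))).aestronglyMeasurable
        (Filter.Eventually.of_forall fun z => by simp)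
    refine h3.congr (Filter.Eventually.of_forall fun z => ?_)
    simp only [Function.uncurry]
    ring

lemma enorm_sum_sq_le {ι : Type*} (s : Finset ι) (f : ι → ℂ) :
    ‖∑ i ∈ s, f i‖ₑ ^ 2 ≤ s.card * ∑ i ∈ s, ‖f i‖ₑ ^ 2 := by
  have h : ‖∑ i ∈ s, f i‖ ^ 2 ≤ s.card * ∑ i ∈ s, ‖f i‖ ^ 2 :=
    (pow_le_pow_left₀ (norm_nonneg _) (norm_sum_le _ _) 2).trans sq_sum_le_card_mul_sum_sq
  have h' := ENNReal.ofReal_le_ofReal h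
  rw [ENNReal.ofReal_pow (norm_nonneg _), ofReal_norm, ENNReal.ofReal_mul (by positivity),
    ENNReal.ofReal_sum_of_nonneg (fun i _ => by positivity), ENNReal.ofReal_natCast] at h'
  simpa only [ENNReal.ofReal_pow (norm_nonneg _), ofReal_norm] using h'

/-- The uniform `L²` bound for the fibre operators at a fixed second frequency `η`. -/
theorem exists_fiber_bound (N : ℕ) (hN : 2 ≤ N) : ∃ K₀ > (0 : ℝ), ∀ θ Φ : ℝ → ℝ,
    IsDyadicCutoff θ (Set.Ioo (1 / 9) 9) → IsDyadicCutoff Φ (Set.Icc (1 / 2) 2) →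
    ∃ D > (0 : ℝ), ∀ K, K₀ ≤ K →
    ∀ l : ℕ, 2 ≤ l → l ≤ N → ∀ a : ℕ → ℝ, a l = 1 → ∀ u : ℝ → ℝ, Measurable u →
    ∀ σ : Fin 4 → ℤˣ, ∀ m : ℕ, ∀ η : ℝ, ∀ h : ℝ → ℂ, Measurable h → Integrable h → MemLp h 2 →
    ∫⁻ x, ‖∫ ξ, h ξ * e (ξ * x) * ∑' j : dominatingSet N K a l,
      symbol θ Φ N l a σ m (j : ℤ) (u x) (ξ, η)‖ₑ ^ 2 ≤
      ENNReal.ofReal (D / Real.sqrt ((2 : ℝ) ^ m)) * ∫⁻ ξ, ‖h ξ‖ₑ ^ 2 := by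
  obtain ⟨K₀, hK₀, H⟩ := exists_single_scale_bound N hN
  refine ⟨K₀, hK₀, fun θ Φ hθ hΦ => ?_⟩
  obtain ⟨B, hB0, hB⟩ := exists_cutoff_bound hΦ
  obtain ⟨D, hD0, H⟩ := H θ hθ (3 * B ^ 2) (by positivity)
  -- 5 is Cauchy–Schwarz over the active scales, 2 comes from `√(2^m / 4)`, and `3 B²` is the
  -- overlap of the cutoffs in `ξ`.
  refine ⟨5 * (2 * D * (3 * B ^ 2)), by positivity, ?_⟩
  intro K hK l hl hlN a hal u hu σ m η h hm h1 h2
  set S := dominatingSet N K a l with hS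
  set φ : ℤ → ℝ → ℂ := fun j ξ =>
    (signed Φ (σ 0) (ξ / (2 : ℝ) ^ (j * (l : ℤ) + (m : ℤ))) : ℂ) with hφ
  have hφc : ∀ j, Continuous (φ j) := fun j =>
    Complex.continuous_ofReal.comp ((continuous_signed hΦ _).comp (by fun_prop))
  have hφb : ∀ j ξ, ‖φ j ξ‖ ≤ B := fun j ξ => by
    simp only [hφ, Complex.norm_real]; exact hB _
  set G : ℤ → ℝ → ℂ := fun j ξ => h ξ * φ j ξ with hG
  have hG1 : ∀ j, Integrable (G j) := fun j =>
    h1.mul_bdd (c := B) (hφc j).aestronglyMeasurable (Filter.Eventually.of_forall (hφb j))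
  have hG2 : ∀ j, MemLp (G j) 2 := fun j => by
    refine MemLp.of_le_mul (c := B) h2 (h2.1.mul (hφc j).aestronglyMeasurable)
      (Filter.Eventually.of_forall fun ξ => ?_)
    rw [hG, norm_mul, mul_comm]
    exact mul_le_mul_of_nonneg_right (hφb j ξ) (norm_nonneg _)
  set g : ℤ → ℝ → ℂ := fun j z => ∫ ξ, G j ξ * e (ξ * z) with hg
  have hgc : ∀ j, Continuous (g j) := fun j => continuous_integral_mul_e (hG1 j)
  have hgb : ∀ j z, ‖g j z‖ ≤ ∫ ξ, ‖G j ξ‖ := fun j z => by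
    refine (norm_integral_le_integral_norm _).trans_eq ?_
    simp
  set W : ℤ → ℝ → ℂ := fun j x => (fiberCut Φ σ m j (u x) η : ℂ) with hW
  have hWm : ∀ j, Measurable (W j) := fun j => Complex.measurable_ofReal.comp
    ((measurable_fiberCut hΦ σ m j).comp (hu.prodMk measurable_const))
  have hWb : ∀ j x, ‖W j x‖ ≤ 3 * B ^ 2 := fun j x => by
    simp only [hW, Complex.norm_real]; exact abs_fiberCut_le hΦ σ m j hB _ _
  set v : ℤ → ℝ → ℝ := fun j x => η * u x * (2 : ℝ) ^ (-j) with hv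
  have hvm : ∀ j, Measurable (v j) := fun j => (hu.const_mul η).mul_const _
  have hWv : ∀ j x, W j x ≠ 0 → (2 : ℝ) ^ m / 4 ≤ |v j x| := by
    intro j x hx
    have hne : fiberCut Φ σ m j (u x) η ≠ 0 := fun h0 => hx (by simp [hW, h0])
    have := (of_fiberCut_ne_zero hΦ σ m j hne).1
    have hp : (0 : ℝ) < 2 ^ (-j) := by positivity
    rw [hv, abs_mul, abs_of_pos hp]
    calc (2 : ℝ) ^ m / 4 = (2 : ℝ) ^ (j + (m : ℤ)) / 4 * 2 ^ (-j) := by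
          rw [zpow_add₀ two_ne_zero, zpow_neg, zpow_natCast]
          field_simp
      _ ≤ _ := mul_le_mul_of_nonneg_right this hp.le
  set Y : ℤ → ℝ → ℂ := fun j x => S.indicator (fun j => W j x * ∫ t, (density θ (σ 3) t : ℂ) *
    e (v j x * t) * g j (x + poly N a ((2 : ℝ) ^ (-j) * t))) j with hY
  have hdc := (contDiff_density hθ (σ 3)).continuous
  have hYm : ∀ j, Measurable (Y j) := by
    intro j
    by_cases hj : j ∈ S
    · simp only [hY, Set.indicator_of_mem hj]
      refine (hWm j).mul ?_
      have hc := continuous_poly N a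
      have : Measurable (Function.uncurry fun x t : ℝ => (density θ (σ 3) t : ℂ) *
          e (v j x * t) * g j (x + poly N a ((2 : ℝ) ^ (-j) * t))) :=
        ((Complex.measurable_ofReal.comp (hdc.measurable.comp measurable_snd)).mul
          (continuous_e.measurable.comp (((hvm j).comp measurable_fst).mul measurable_snd))).mul
          ((hgc j).comp (by fun_prop : Continuous fun q : ℝ × ℝ =>
            q.1 + poly N a ((2 : ℝ) ^ (-j) * q.2))).measurable
      exact (this.stronglyMeasurable.integral_prod_right (ν := volume)).measurable
    · simp only [hY, Set.indicator_of_notMem hj]; exact measurable_const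
  have hYi : ∀ j, ∫⁻ x, ‖Y j x‖ₑ ^ 2 ≤ ENNReal.ofReal (2 * D / Real.sqrt ((2 : ℝ) ^ m)) *
      ∫⁻ ξ, ‖G j ξ‖ₑ ^ 2 := by
    intro j
    by_cases hj : j ∈ S
    · simp only [hY, Set.indicator_of_mem hj]
      have key := H K hK l hl hlN a hal j hj (σ 3) (W j) (hWm j) (hWb j) (v j) (hvm j)
        ((2 : ℝ) ^ m / 4) (by positivity) (hWv j) (g j) (hgc j).measurable _ (hgb j)
      have hsq : Real.sqrt ((2 : ℝ) ^ m / 4) = Real.sqrt ((2 : ℝ) ^ m) / 2 := by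
        rw [Real.sqrt_div (by positivity), show (4 : ℝ) = 2 ^ 2 by norm_num,
          Real.sqrt_sq (by norm_num)]
      rw [hsq, show D / (Real.sqrt ((2 : ℝ) ^ m) / 2) = 2 * D / Real.sqrt ((2 : ℝ) ^ m) by
        field_simp] at key
      exact key.trans (mul_le_mul_right (lintegral_fourierInv_sq_le (hG1 j) (hG2 j)) _)
    · simp [hY, Set.indicator_of_notMem hj]
  -- At each `x` only the five scales of the window contribute. After Cauchy–Schwarz the sum is
  -- extended to all `j`, so the dependence of the window on `x` disappears.
  have hpt : ∀ x, ‖∫ ξ, h ξ * e (ξ * x) * ∑' j : S, symbol θ Φ N l a σ m (j : ℤ) (u x) (ξ, η)‖ₑ ^ 2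
      ≤ 5 * ∑' j, ‖Y j x‖ₑ ^ 2 := by
    intro x
    obtain ⟨J, hJ5, hJ⟩ := exists_scale_window hΦ σ m (η * u x)
    have hout : ∀ ξ, ∀ j ∉ J, S.indicator (fun j => symbol θ Φ N l a σ m j (u x) (ξ, η)) j = 0 := by
      intro ξ j hj
      have h0 : fiberCut Φ σ m j (u x) η = 0 := by
        by_contra hne; exact hj (hJ j _ _ rfl hne)
      refine Set.indicator_apply_eq_zero.2 fun _ => ?_
      rw [symbol_eq, h0]; simp
    have e1 : ∀ ξ, h ξ * e (ξ * x) * ∑' j : S, symbol θ Φ N l a σ m (j : ℤ) (u x) (ξ, η) =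
        ∑ j ∈ J, h ξ * e (ξ * x) *
          S.indicator (fun j => symbol θ Φ N l a σ m j (u x) (ξ, η)) j := by
      intro ξ
      rw [tsum_subtype S fun j => symbol θ Φ N l a σ m j (u x) (ξ, η), tsum_eq_sum (hout ξ),
        Finset.mul_sum]
    simp_rw [e1]
    have hint : ∀ j, ∫ ξ, h ξ * e (ξ * x) *
        S.indicator (fun j => symbol θ Φ N l a σ m j (u x) (ξ, η)) j = Y j x := by
      intro j
      by_cases hj : j ∈ S
      · simp only [hY, Set.indicator_of_mem hj]
        exact integral_symbol_eq hθ N l a σ m j (u x) η x (hG1 j)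
      · simp [hY, Set.indicator_of_notMem hj]
    rw [integral_finsetSum]
    · simp_rw [hint]
      refine (enorm_sum_sq_le J fun j => Y j x).trans ?_
      rw [hJ5]
      exact mul_le_mul_right (ENNReal.sum_le_tsum J) _
    · intro j _
      by_cases hj : j ∈ S
      · simp only [Set.indicator_of_mem hj]
        obtain ⟨A, hA⟩ := exists_symbol_bound θ hΦ
        refine (h1.mul_bdd (c := 1) (continuous_e.comp (by fun_prop)).aestronglyMeasurable
          (Filter.Eventually.of_forall fun ξ => by simp)).mul_bdd (c := A)
          (((measurable_symbol hθ hΦ N l a σ m j).comp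
            (measurable_const.prodMk (measurable_id.prodMk measurable_const))).aestronglyMeasurable)
          (Filter.Eventually.of_forall fun ξ => hA N l a σ m j (u x) (ξ, η))
      · simp [Set.indicator_of_notMem hj]
  calc _ ≤ ∫⁻ x, 5 * ∑' j, ‖Y j x‖ₑ ^ 2 := lintegral_mono hpt
    _ = 5 * ∑' j, ∫⁻ x, ‖Y j x‖ₑ ^ 2 := by
        rw [lintegral_const_mul' _ _ (by norm_num), lintegral_tsum]
        exact fun j => ((hYm j).enorm.pow_const 2).aemeasurable
    _ ≤ 5 * ∑' j, ENNReal.ofReal (2 * D / Real.sqrt ((2 : ℝ) ^ m)) * ∫⁻ ξ, ‖G j ξ‖ₑ ^ 2 :=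
        mul_le_mul_right (ENNReal.tsum_le_tsum hYi) _
    _ = 5 * (ENNReal.ofReal (2 * D / Real.sqrt ((2 : ℝ) ^ m)) *
          ∫⁻ ξ, ∑' j, ‖G j ξ‖ₑ ^ 2) := by
        rw [ENNReal.tsum_mul_left, lintegral_tsum]
        exact fun j => ((hm.mul (hφc j).measurable).enorm.pow_const 2).aemeasurable
    _ ≤ 5 * (ENNReal.ofReal (2 * D / Real.sqrt ((2 : ℝ) ^ m)) *
          ∫⁻ ξ, ‖h ξ‖ₑ ^ 2 * ENNReal.ofReal (3 * B ^ 2)) := by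
        refine mul_le_mul_right (mul_le_mul_right (lintegral_mono fun ξ => ?_) _) _
        simp only [hG, enorm_mul, mul_pow]
        rw [ENNReal.tsum_mul_left]
        refine mul_le_mul_right (le_of_eq_of_le ?_
          (tsum_signed_sq_le hΦ hB (σ 0) ξ (by omega : l ≠ 0) m)) _
        congr 1; ext j
        simp only [hφ, ← ofReal_norm, Complex.norm_real]
    _ = _ := by
        rw [lintegral_mul_const' _ _ ENNReal.ofReal_ne_top, mul_comm (∫⁻ ξ, ‖h ξ‖ₑ ^ 2),
          ← mul_assoc, ← mul_assoc, ← ENNReal.ofReal_ofNat 5, ← ENNReal.ofReal_mul (by norm_num),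
          ← ENNReal.ofReal_mul (by positivity)]
        congr 2
        ring

/-! ### Reduction from the plane to the fibres -/

/-- Square integrability need not be known in advance: if it fails, the right side is infinite. This
allows Plancherel to be applied in `y` to slices known only to be integrable. -/
lemma lintegral_fourierInv_sq_le_of_integrable {G : ℝ → ℂ} (h1 : Integrable G) :
    ∫⁻ y, ‖∫ η, G η * e (η * y)‖ₑ ^ 2 ≤ ∫⁻ η, ‖G η‖ₑ ^ 2 := by
  by_cases h : ∫⁻ η, ‖G η‖ₑ ^ 2 = ⊤
  · rw [h]; exact le_top
  · refine lintegral_fourierInv_sq_le h1 ⟨h1.1, lt_top_iff_ne_top.2 fun h2 => h ?_⟩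
    rw [lintegral_sq_eq_eLpNorm_sq, h2]; rfl

open FourierTransform in
/-- The planar Fourier transform preserves Schwartz functions and the `L²` norm. -/
lemma exists_schwartz_fourier (f : 𝓢(ℝ × ℝ, ℂ)) : ∃ F : 𝓢(ℝ × ℝ, ℂ),
    (∀ ζ, F ζ = fourier f ζ) ∧ ∫⁻ ζ, ‖F ζ‖ₑ ^ 2 = ∫⁻ z, ‖f z‖ₑ ^ 2 := by
  -- `ℝ × ℝ` carries the sup norm, whereas the Fourier transform of Schwartz functions lives on an
  -- inner product space; the identification with `WithLp 2` preserves measure.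
  set L : WithLp 2 (ℝ × ℝ) ≃L[ℝ] ℝ × ℝ := WithLp.prodContinuousLinearEquiv 2 ℝ ℝ ℝ with hL
  set f' : 𝓢(WithLp 2 (ℝ × ℝ), ℂ) := SchwartzMap.compCLMOfContinuousLinearEquiv ℂ L f with hf'
  set F : 𝓢(ℝ × ℝ, ℂ) := SchwartzMap.compCLMOfContinuousLinearEquiv ℂ L.symm (𝓕 f') with hF
  have hmp : MeasurePreserving (L : WithLp 2 (ℝ × ℝ) → ℝ × ℝ) volume volume :=
    WithLp.volume_preserving_ofLp ℝ ℝ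
  have hme : MeasurableEmbedding (L : WithLp 2 (ℝ × ℝ) → ℝ × ℝ) :=
    L.toHomeomorph.measurableEmbedding
  refine ⟨F, fun ζ => ?_, ?_⟩
  · have e1 : F ζ = 𝓕 (f' : WithLp 2 (ℝ × ℝ) → ℂ) (L.symm ζ) := rfl
    rw [e1, Real.fourier_eq, fourier, ← hmp.integral_comp hme]
    congr 1; ext v
    rw [Circle.smul_def, fourierChar_eq_e, smul_eq_mul]
    have h2 : f' v = f (L v) := rfl
    rw [h2]
    congr 2
  · have e1 : ∫⁻ ζ, ‖F ζ‖ₑ ^ 2 = ∫⁻ v, ‖(𝓕 f') v‖ₑ ^ 2 := by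
      rw [← hmp.lintegral_comp_emb hme]
      congr 1
    have e2 : ∫⁻ z, ‖f z‖ₑ ^ 2 = ∫⁻ v, ‖f' v‖ₑ ^ 2 := by
      rw [← hmp.lintegral_comp_emb hme]; rfl
    have e3 := SchwartzMap.norm_fourier_toL2_eq f'
    rw [e1, e2, lintegral_sq_eq_eLpNorm_sq, lintegral_sq_eq_eLpNorm_sq]
    rw [SchwartzMap.norm_toLp, SchwartzMap.norm_toLp] at e3
    have t1 : eLpNorm (𝓕 f' : 𝓢(WithLp 2 (ℝ × ℝ), ℂ)) 2 volume ≠ ⊤ :=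
      (SchwartzMap.memLp (𝓕 f') 2 volume).2.ne
    have t2 : eLpNorm f' 2 volume ≠ ⊤ := (SchwartzMap.memLp f' 2 volume).2.ne
    rw [(ENNReal.toReal_eq_toReal_iff' t1 t2).1 e3]

section highFreq

variable {θ Φ : ℝ → ℝ}

/-- The integrand of `highFreq`. -/
noncomputable def integrand (θ Φ : ℝ → ℝ) (N l : ℕ) (K : ℝ) (a : ℕ → ℝ) (u : ℝ → ℝ)
    (σ : Fin 4 → ℤˣ) (m : ℕ) (F : ℝ × ℝ → ℂ) (z ζ : ℝ × ℝ) : ℂ :=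
  F ζ * e (ζ.1 * z.1 + ζ.2 * z.2) *
    ∑' j : dominatingSet N K a l, symbol θ Φ N l a σ m (j : ℤ) (u z.1) ζ

variable (hθ : IsDyadicCutoff θ (Set.Ioo (1 / 9) 9)) (hΦ : IsDyadicCutoff Φ (Set.Icc (1 / 2) 2))
  (N l : ℕ) (K : ℝ) (a : ℕ → ℝ) {u : ℝ → ℝ} (hu : Measurable u) (σ : Fin 4 → ℤˣ) (m : ℕ)
include hθ hΦ hu

lemma measurable_integrand {F : ℝ × ℝ → ℂ} (hF : Measurable F) :
    Measurable (Function.uncurry (integrand θ Φ N l K a u σ m F)) := by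
  obtain ⟨A, hA⟩ := exists_tsum_symbol_bound hθ hΦ
  have h1 : Measurable fun q : (ℝ × ℝ) × (ℝ × ℝ) => F q.2 := hF.comp measurable_snd
  have h2 : Measurable fun q : (ℝ × ℝ) × (ℝ × ℝ) => e (q.2.1 * q.1.1 + q.2.2 * q.1.2) :=
    continuous_e.measurable.comp (by fun_prop)
  have h3 : Measurable fun q : (ℝ × ℝ) × (ℝ × ℝ) => (u q.1.1, q.2) := by fun_prop
  have h4 := (hA N l a (dominatingSet N K a l) σ m).1.comp h3
  exact (h1.mul h2).mul h4

lemma integrable_integrand {F : ℝ × ℝ → ℂ} (hFm : Measurable F) (hF : Integrable F) (z : ℝ × ℝ) :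
    Integrable (integrand θ Φ N l K a u σ m F z) := by
  obtain ⟨A, hA⟩ := exists_tsum_symbol_bound hθ hΦ
  have hA' := (hA N l a (dominatingSet N K a l) σ m).2
  refine Integrable.mono' (hF.norm.mul_const A) ?_ (Filter.Eventually.of_forall fun ζ => ?_)
  · exact ((measurable_integrand hθ hΦ N l K a hu σ m hFm).comp
      measurable_prodMk_left).aestronglyMeasurable
  · rw [integrand, norm_mul, norm_mul, norm_e, mul_one]
    exact mul_le_mul_of_nonneg_left (hA' _ _) (norm_nonneg _)

/-- The reduction of the planar estimate to the fibre operators, by Plancherel in `y`. -/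
lemma lintegral_integral_integrand_le {F : ℝ × ℝ → ℂ} (hFc : Continuous F) (hF : Integrable F)
    {M : ℝ} (hM : ∀ ζ, ‖F ζ‖ ≤ M) {D : ENNReal}
    (hD : ∀ η : ℝ, ∀ h : ℝ → ℂ, Measurable h → Integrable h → MemLp h 2 →
      ∫⁻ x, ‖∫ ξ, h ξ * e (ξ * x) * ∑' j : dominatingSet N K a l,
        symbol θ Φ N l a σ m (j : ℤ) (u x) (ξ, η)‖ₑ ^ 2 ≤ D * ∫⁻ ξ, ‖h ξ‖ₑ ^ 2) :
    ∫⁻ z, ‖∫ ζ, integrand θ Φ N l K a u σ m F z ζ‖ₑ ^ 2 ≤ D * ∫⁻ ζ, ‖F ζ‖ₑ ^ 2 := by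
  have hmeas := measurable_integrand hθ hΦ N l K a hu σ m hFc.measurable
  set G : ℝ → ℝ → ℂ := fun x η => ∫ ξ, F (ξ, η) * e (ξ * x) *
    ∑' j : dominatingSet N K a l, symbol θ Φ N l a σ m (j : ℤ) (u x) (ξ, η) with hG
  -- The symbol does not see `y`, so `G` is the `ξ` integral of the integrand at `y = 0`; general
  -- `y` only adds the factor `e(η y)`.
  have hG0 : ∀ x η ξ, integrand θ Φ N l K a u σ m F (x, 0) (ξ, η) = F (ξ, η) * e (ξ * x) *
    ∑' j : dominatingSet N K a l, symbol θ Φ N l a σ m (j : ℤ) (u x) (ξ, η) := by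
    intro x η ξ; simp [integrand]
  have hGm : Measurable (Function.uncurry G) := by
    have : Measurable (Function.uncurry fun (q : ℝ × ℝ) (ξ : ℝ) =>
        integrand θ Φ N l K a u σ m F (q.1, 0) (ξ, q.2)) :=
      hmeas.comp (by fun_prop : Measurable fun q : (ℝ × ℝ) × ℝ =>
        (((q.1.1, 0), (q.2, q.1.2)) : (ℝ × ℝ) × (ℝ × ℝ)))
    have h2 := (this.stronglyMeasurable.integral_prod_right (ν := volume)).measurable
    simp_rw [hG0] at h2
    exact h2
  have hint : ∀ z, Integrable (integrand θ Φ N l K a u σ m F z) (volume.prod volume) :=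
    fun z => integrable_integrand hθ hΦ N l K a hu σ m hFc.measurable hF z
  have hGi : ∀ x, Integrable (G x) := by
    intro x
    have := (hint (x, 0)).integral_prod_right
    simpa only [hG0] using this
  have hfib : ∀ x y, ∫ ζ, integrand θ Φ N l K a u σ m F (x, y) ζ = ∫ η, G x η * e (η * y) := by
    intro x y
    rw [Measure.volume_eq_prod, integral_prod_symm _ (hint (x, y))]
    congr 1; ext η
    simp only [hG]
    rw [← integral_mul_const]
    congr 1; ext ξ
    simp only [integrand]
    rw [e_add]; ring
  have hIm : Measurable fun z => ∫ ζ, integrand θ Φ N l K a u σ m F z ζ :=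
    (hmeas.stronglyMeasurable.integral_prod_right (ν := volume)).measurable
  -- Joint integrability gives integrable slices for almost every `η`, which is enough under the
  -- outer integral.
  have hslice : ∀ᵐ η : ℝ, Integrable fun ξ => F (ξ, η) := by
    have : Integrable F (volume.prod volume) := hF
    exact this.prod_left_ae
  calc ∫⁻ z, ‖∫ ζ, integrand θ Φ N l K a u σ m F z ζ‖ₑ ^ 2
      = ∫⁻ x, ∫⁻ y, ‖∫ η, G x η * e (η * y)‖ₑ ^ 2 := by
        simp_rw [← hfib]
        exact lintegral_prod (μ := volume) (ν := volume) _ (hIm.enorm.pow_const 2).aemeasurable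
    _ ≤ ∫⁻ x, ∫⁻ η, ‖G x η‖ₑ ^ 2 :=
        lintegral_mono fun x => lintegral_fourierInv_sq_le_of_integrable (hGi x)
    _ = ∫⁻ η, ∫⁻ x, ‖G x η‖ₑ ^ 2 :=
        lintegral_lintegral_swap (hGm.enorm.pow_const 2).aemeasurable
    _ ≤ ∫⁻ η, D * ∫⁻ ξ, ‖F (ξ, η)‖ₑ ^ 2 := by
        refine lintegral_mono_ae ?_
        filter_upwards [hslice] with η hη
        have hc : Continuous fun ξ => F (ξ, η) := by fun_prop
        refine hD η (fun ξ => F (ξ, η)) hc.measurable hη ?_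
        refine (memLp_two_iff_integrable_sq_norm hc.aestronglyMeasurable).2 ?_
        refine (hη.norm.mul_const M).mono' (by fun_prop) (Filter.Eventually.of_forall fun ξ => ?_)
        rw [Real.norm_of_nonneg (by positivity), sq]
        exact mul_le_mul_of_nonneg_left (hM _) (norm_nonneg _)
    _ = D * ∫⁻ ζ, ‖F ζ‖ₑ ^ 2 := by
        have hm2 : Measurable fun ζ => ‖F ζ‖ₑ ^ 2 := hFc.measurable.enorm.pow_const 2
        rw [lintegral_const_mul _ (hm2.lintegral_prod_left'), Measure.volume_eq_prod,
          lintegral_prod_symm _ hm2.aemeasurable]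

end highFreq

/-! ### Extension to `L²` and conclusion -/

lemma highFreq_eq (θ Φ : ℝ → ℝ) (N l : ℕ) (K : ℝ) (a : ℕ → ℝ) (u : ℝ → ℝ) (σ : Fin 4 → ℤˣ) (m : ℕ)
    (f : ℝ × ℝ → ℂ) (z : ℝ × ℝ) : highFreq θ Φ N l K a u σ m f z =
      ∫ ζ, integrand θ Φ N l K a u σ m (fourier f) z ζ := rfl

lemma fourier_add (f g : 𝓢(ℝ × ℝ, ℂ)) : fourier (f + g : 𝓢(ℝ × ℝ, ℂ)) = fourier f + fourier g := by
  have hi : ∀ (h : 𝓢(ℝ × ℝ, ℂ)) (ζ : ℝ × ℝ),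
      Integrable fun z : ℝ × ℝ => e (-(ζ.1 * z.1 + ζ.2 * z.2)) * h z := fun h ζ =>
    (h.integrable (μ := volume)).bdd_mul (c := 1)
      (continuous_e.comp (by fun_prop)).aestronglyMeasurable
      (Filter.Eventually.of_forall fun z => by simp)
  ext ζ
  simp only [fourier, Pi.add_apply]
  rw [← integral_add (hi f ζ) (hi g ζ)]
  congr 1; ext z
  rw [add_apply, mul_add]

lemma fourier_smul (c : ℂ) (f : 𝓢(ℝ × ℝ, ℂ)) :
    fourier (c • f : 𝓢(ℝ × ℝ, ℂ)) = c • fourier f := by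
  ext ζ
  simp only [fourier, Pi.smul_apply, smul_eq_mul]
  rw [← integral_const_mul]
  congr 1; ext z
  rw [smul_apply, smul_eq_mul]; ring

/-- A linear operator on Schwartz functions that is bounded in `L²` extends to `L²`. -/
lemma exists_extension {H : 𝓢(ℝ × ℝ, ℂ) → ℝ × ℝ → ℂ} (hm : ∀ f, Measurable (H f))
    (hadd : ∀ f g, H (f + g) = H f + H g) (hsmul : ∀ (c : ℂ) f, H (c • f) = c • H f) {D : ℝ}
    (hD : 0 ≤ D) (hb : ∀ f, ∫⁻ z, ‖H f z‖ₑ ^ 2 ≤ ENNReal.ofReal (D ^ 2) * ∫⁻ z, ‖f z‖ₑ ^ 2) :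
    ∃ T : Lp ℂ 2 (volume : Measure (ℝ × ℝ)) →L[ℂ] Lp ℂ 2 (volume : Measure (ℝ × ℝ)),
      (∀ f : 𝓢(ℝ × ℝ, ℂ), (T (f.toLp 2 volume) : ℝ × ℝ → ℂ) =ᵐ[volume] H f) ∧
      ∀ f : Lp ℂ 2 (volume : Measure (ℝ × ℝ)), ‖T f‖ ≤ D * ‖f‖ := by
  have hb' : ∀ f : 𝓢(ℝ × ℝ, ℂ), eLpNorm (H f) 2 volume ≤
      ENNReal.ofReal D * eLpNorm f 2 volume := by
    intro f
    have h := hb f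
    rw [lintegral_sq_eq_eLpNorm_sq, lintegral_sq_eq_eLpNorm_sq, ENNReal.ofReal_pow hD,
      ← mul_pow] at h
    exact (ENNReal.pow_le_pow_left_iff two_ne_zero).1 h
  have hmem : ∀ f : 𝓢(ℝ × ℝ, ℂ), MemLp (H f) 2 volume := fun f =>
    ⟨(hm f).aestronglyMeasurable, (hb' f).trans_lt
      (ENNReal.mul_lt_top ENNReal.ofReal_lt_top (f.memLp 2 volume).2)⟩
  let T₀ : 𝓢(ℝ × ℝ, ℂ) →ₗ[ℂ] Lp ℂ 2 (volume : Measure (ℝ × ℝ)) :=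
    { toFun := fun f => (hmem f).toLp (H f)
      map_add' := fun f g => by
        rw [← MemLp.toLp_add]
        exact MemLp.toLp_congr _ _ (by rw [hadd])
      map_smul' := fun c f => by
        rw [RingHom.id_apply, ← MemLp.toLp_const_smul]
        exact MemLp.toLp_congr _ _ (by rw [hsmul]) }
  let ι : 𝓢(ℝ × ℝ, ℂ) →ₗ[ℂ] Lp ℂ 2 (volume : Measure (ℝ × ℝ)) :=
    (SchwartzMap.toLpCLM ℂ ℂ 2 (volume : Measure (ℝ × ℝ))).toLinearMap
  have hdense : DenseRange ι := SchwartzMap.denseRange_toLpCLM ENNReal.ofNat_ne_top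
  have hnorm : ∀ f, ‖T₀ f‖ ≤ D * ‖ι f‖ := by
    intro f
    have e1 : ‖T₀ f‖ = (eLpNorm (H f) 2 volume).toReal := Lp.norm_toLp _ (hmem f)
    have e2 : ‖ι f‖ = (eLpNorm f 2 volume).toReal := SchwartzMap.norm_toLp
    rw [e1, e2, ← ENNReal.toReal_ofReal hD, ← ENNReal.toReal_mul]
    exact ENNReal.toReal_mono
      (ENNReal.mul_lt_top ENNReal.ofReal_lt_top (f.memLp 2 volume).2).ne (hb' f)
  refine ⟨T₀.extendOfNorm ι, fun f => ?_, fun f =>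
    LinearMap.norm_extendOfNorm_apply_le hdense D hnorm f⟩
  have : T₀.extendOfNorm ι (f.toLp 2 volume) = T₀ f :=
    LinearMap.extendOfNorm_eq hdense ⟨D, hnorm⟩ f
  rw [this]
  exact (hmem f).coeFn_toLp

end PolyHilbert

theorem lemma6p1 (N : ℕ) (hN : 2 ≤ N) :
    ∃ ε₀ : ℝ, 0 < ε₀ ∧ ∃ K₀ : ℝ, 0 < K₀ ∧
      ∀ θ Φ : ℝ → ℝ,
        PolyHilbert.IsDyadicCutoff θ (Set.Ioo (1 / 9) 9) →
        PolyHilbert.IsDyadicCutoff Φ (Set.Icc (1 / 2) 2) →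
        ∃ C : ℝ, 0 < C ∧
          ∀ K : ℝ, K₀ ≤ K →
          ∀ l : ℕ, 2 ≤ l → l ≤ N →
          ∀ a : ℕ → ℝ, a l = 1 →
          ∀ u : ℝ → ℝ, Measurable u →
          ∀ σ : Fin 4 → ℤˣ,
          ∀ m : ℕ, 0 < m →
            ∃ T : Lp ℂ 2 (volume : Measure (ℝ × ℝ)) →L[ℂ] Lp ℂ 2 (volume : Measure (ℝ × ℝ)),
              (∀ f : 𝓢(ℝ × ℝ, ℂ),
                (T (f.toLp 2 volume) : ℝ × ℝ → ℂ) =ᵐ[volume]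
                  PolyHilbert.highFreq θ Φ N l K a u σ m f) ∧
              ∀ f : Lp ℂ 2 (volume : Measure (ℝ × ℝ)),
                ‖T f‖ ≤ C * (2 : ℝ) ^ (-(ε₀ * (m : ℝ))) * ‖f‖ := by
  obtain ⟨K₀, hK₀, H⟩ := PolyHilbert.exists_fiber_bound N hN
  -- The fibre bound controls squared norms by `D · 2^{-m/2}`; taking square roots gives the
  -- exponent `1/4` and the constant `√D`.
  refine ⟨1 / 4, by norm_num, K₀, hK₀, fun θ Φ hθ hΦ => ?_⟩
  obtain ⟨D, hD, H⟩ := H θ Φ hθ hΦ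
  refine ⟨Real.sqrt D, Real.sqrt_pos.2 hD, ?_⟩
  intro K hK l hl hlN a hal u hu σ m _
  have hconst : (Real.sqrt D * (2 : ℝ) ^ (-(1 / 4 * (m : ℝ)))) ^ 2 =
      D / Real.sqrt ((2 : ℝ) ^ m) := by
    rw [mul_pow, Real.sq_sqrt hD.le, ← Real.rpow_natCast _ 2, ← Real.rpow_mul two_pos.le,
      Real.sqrt_eq_rpow, ← Real.rpow_natCast 2 m, ← Real.rpow_mul two_pos.le, div_eq_mul_inv D,
      ← Real.rpow_neg two_pos.le]
    congr 2
    push_cast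
    ring
  have hF : ∀ f : 𝓢(ℝ × ℝ, ℂ), Continuous (PolyHilbert.fourier f) ∧
      Integrable (PolyHilbert.fourier f) ∧ (∃ M, ∀ ζ, ‖PolyHilbert.fourier f ζ‖ ≤ M) ∧
      ∫⁻ ζ, ‖PolyHilbert.fourier f ζ‖ₑ ^ 2 = ∫⁻ z, ‖f z‖ₑ ^ 2 := by
    intro f
    obtain ⟨F, hF1, hF2⟩ := PolyHilbert.exists_schwartz_fourier f
    have hFe : (F : ℝ × ℝ → ℂ) = PolyHilbert.fourier f := funext hF1
    rw [← hFe]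
    exact ⟨F.continuous, F.integrable, ⟨_, F.norm_le_seminorm ℝ⟩, hF2⟩
  refine PolyHilbert.exists_extension (H := fun f => PolyHilbert.highFreq θ Φ N l K a u σ m f)
    (fun f => ?_) (fun f g => ?_) (fun c f => ?_) (by positivity) (fun f => ?_)
  · exact ((PolyHilbert.measurable_integrand hθ hΦ N l K a hu σ m
      (hF f).1.measurable).stronglyMeasurable.integral_prod_right (ν := volume)).measurable
  · ext z
    simp only [PolyHilbert.highFreq_eq, Pi.add_apply]
    rw [← integral_add
      (PolyHilbert.integrable_integrand hθ hΦ N l K a hu σ m (hF f).1.measurable (hF f).2.1 z)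
      (PolyHilbert.integrable_integrand hθ hΦ N l K a hu σ m (hF g).1.measurable (hF g).2.1 z)]
    congr 1; ext ζ
    simp only [PolyHilbert.integrand, PolyHilbert.fourier_add, Pi.add_apply]
    ring
  · ext z
    simp only [PolyHilbert.highFreq_eq, Pi.smul_apply, smul_eq_mul]
    rw [← integral_const_mul]
    congr 1; ext ζ
    simp only [PolyHilbert.integrand, PolyHilbert.fourier_smul, Pi.smul_apply, smul_eq_mul]
    ring
  · obtain ⟨h1, h2, ⟨M, hM⟩, h4⟩ := hF f
    rw [hconst, ← h4]
    exact PolyHilbert.lintegral_integral_integrand_le hθ hΦ N l K a hu σ m h1 h2 hM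
      (fun η h hm hi h2 => H K hK l hl hlN a hal u hu σ m η h hm hi h2)
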